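/- Let $n\ge 2$ and let $\mathcal K$ be the set of compact convex sets $K\subset\mathbb R^n$ with the origin in the interior whose boundary is a smooth hypersurface (a smoothly embedded $\mathbb S^{n-1}$) of positive Gauss curvature. For a smooth embedding $X:\mathbb S^{n-1}\to\mathbb R^n$ with image $\partial K$, $K\in\mathcal K$, denote by $\nu(u)$ the outer unit normal of $K$ at $X(u)$, by $\mathscr K(u)$ the Gauss curvature of $\partial K$ at $X(u)$, by $$\kappa_0(u)=\frac{\mathscr K(u)}{(X(u)\cdot \nu(u))^{n+1}}$$ the centro-affine curvature, and by $\mathcal N=\frac1{n-1}\Delta_g X$ the affine normal vector, where $\Delta_g$ is the Laplace–Beltrami operator of the Blaschke metric $g=\mathscr K^{-1/(n+1)}\,\mathrm{II}$, applied to each component of $X$; here $\mathrm{II}$ is the (positive definite) second fundamental form. (Thus $\mathcal N\cdot\nu=-\mathscr K^{1/(n+1)}$.) Let $p$ be a real number, $p\ne 0$, $p\neq -n$. A solution in $\mathcal K$ of the $p$-flow on $[0,T)$ with initial body $K\in\mathcal K$ is a family $X(\cdot,t)$, $0\le t<T$, of smooth embeddings of $\mathbb S^{n-1}$, jointly smooth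 on $\mathbb S^{n-1}\times[0,T)$, whose images are the boundaries of bodies $K(t)\in\mathcal K$, such that $$\frac{\partial X}{\partial t}(u,t)=\operatorname{sgn}\Big(\frac{p}{n+p}\Big)\,\kappa_0(u,t)^{\frac{n(p-1)}{(n+1)(n+p)}}\,\mathcal N(u,t),\qquad X(u,0)=X_K(u),$$ where $\kappa_0(u,t)$ and $\mathcal N(u,t)$ are taken at the point $X(u,t)$ of $\partial K(t)$, and $X_K(u)$ is the point of $\partial K$ with outer unit normal $u$. **Containment Principle.** Let $K_{in},K_{out}\in\mathcal K$ with $K_{in}\subseteq K_{out}$, and let $K_{in}(t)$, $0\le t<T_{in}$, and $K_{out}(t)$, $0\le t<T_{out}$, be solutions in $\mathcal K$ of the $p$-flow with initial bodies $K_{in}$ and $K_{out}$. Then $K_{in}(t)\subseteq K_{out}(t)$ for all $0\le t<\min(T_{in},T_{out})$. -/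

import Mathlib

open scoped Manifold ContDiff

noncomputable section

namespace CentroAffine

/-- The ambient space `ℝ^n`, with `n = d + 1`. -/
abbrev Space (d : ℕ) : Type := EuclideanSpace ℝ (Fin (d + 1))

/-- The unit sphere `𝕊^{n-1}` of `ℝ^n`, with `n = d + 1`. -/
abbrev USphere (d : ℕ) : Type := Metric.sphere (0 : Space d) 1

/-- The parameter space of local coordinates on a hypersurface of `ℝ^{d+1}`. -/
abbrev Coord (d : ℕ) : Type := EuclideanSpace ℝ (Fin d)

section Local

variable {d : ℕ}

/-- The partial derivative `∂ᵢ f` at `y`. -/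
def pd {F : Type*} [NormedAddCommGroup F] [NormedSpace ℝ F]
    (i : Fin d) (f : Coord d → F) (y : Coord d) : F :=
  fderiv ℝ f y (EuclideanSpace.single i 1)

/-- First fundamental form `⟨∂ᵢY, ∂ⱼY⟩` of a local parametrization `Y` of a hypersurface. -/
def firstForm (Y : Coord d → Space d) (y : Coord d) : Matrix (Fin d) (Fin d) ℝ :=
  Matrix.of fun i j => inner ℝ (pd i Y y) (pd j Y y)

/-- Second fundamental form `-⟨∂ᵢ∂ⱼY, N⟩` with respect to the unit normal `N`. With `N` the outer
normal of a convex body it is positive semidefinite. -/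
def secondForm (Y N : Coord d → Space d) (y : Coord d) : Matrix (Fin d) (Fin d) ℝ :=
  Matrix.of fun i j => - inner ℝ (pd i (pd j Y) y) (N y)

/-- Gauss curvature `det II / det I`. -/
def localGaussCurvature (Y N : Coord d → Space d) (y : Coord d) : ℝ :=
  (secondForm Y N y).det / (firstForm Y y).det

/-- The Blaschke metric of a locally strictly convex hypersurface of `ℝ^n`, `n = d + 1`: it is
`𝒦^{-1/(n+1)} II`, where `𝒦` is the Gauss curvature. -/
def blaschkeMetric (Y N : Coord d → Space d) (y : Coord d) : Matrix (Fin d) (Fin d) ℝ :=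
  (localGaussCurvature Y N y) ^ (-1 / ((d : ℝ) + 2)) • secondForm Y N y

/-- Christoffel symbol `Γᵢⱼᵏ = ½ ∑ₗ gᵏˡ (∂ᵢ gⱼₗ + ∂ⱼ gᵢₗ - ∂ₗ gᵢⱼ)` of the metric `g`. -/
def christoffel (g : Coord d → Matrix (Fin d) (Fin d) ℝ) (i j k : Fin d) (y : Coord d) : ℝ :=
  (1 / 2) * ∑ l, (g y)⁻¹ k l *
    (pd i (fun z => g z j l) y + pd j (fun z => g z i l) y - pd l (fun z => g z i j) y)

/-- Laplace-Beltrami operator `Δ_g f = ∑ gⁱʲ (∂ᵢ∂ⱼ f - Γᵢⱼᵏ ∂ₖ f)` of the metric `g`, acting on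
vector-valued functions component by component. -/
def laplaceBeltrami {F : Type*} [NormedAddCommGroup F] [NormedSpace ℝ F]
    (g : Coord d → Matrix (Fin d) (Fin d) ℝ) (f : Coord d → F) (y : Coord d) : F :=
  ∑ i, ∑ j, (g y)⁻¹ i j • (pd i (pd j f) y - ∑ k, christoffel g i j k y • pd k f y)

/-- Affine normal `(1/d) Δ_g Y` of a hypersurface of dimension `d`, `g` the Blaschke metric. -/
def localAffineNormal (Y N : Coord d → Space d) (y : Coord d) : Space d :=
  (1 / (d : ℝ)) • laplaceBeltrami (blaschkeMetric Y N) Y y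

end Local

section Global

variable {d : ℕ}

/-- A map on the sphere, written in the standard (stereographic) coordinates around `u`. -/
def inChart (f : USphere d → Space d) (u : USphere d) : Coord d → Space d :=
  fun y => f ((chartAt (Coord d) u).symm y)

/-- Gauss curvature at the point `X u` of the hypersurface `X` with unit normal field `ν`. -/
def gaussCurvature (X ν : USphere d → Space d) (u : USphere d) : ℝ :=
  localGaussCurvature (inChart X u) (inChart ν u) (chartAt (Coord d) u u)

/-- Centro-affine curvature `κ₀ = 𝒦 / (X · ν)^{n+1}`, with `n = d + 1`. -/
def centroAffineCurvature (X ν : USphere d → Space d) (u : USphere d) : ℝ :=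
  gaussCurvature X ν u / (inner ℝ (X u) (ν u)) ^ (d + 2)

/-- Affine normal vector at the point `X u`. -/
def affineNormal (X ν : USphere d → Space d) (u : USphere d) : Space d :=
  localAffineNormal (inChart X u) (inChart ν u) (chartAt (Coord d) u u)

/-- `X` is a smooth embedding of the sphere onto the boundary of `K`, `ν u` is the outer unit normal
of `K` at `X u`, and the Gauss curvature is positive at every boundary point. -/
structure IsBoundaryParam (K : Set (Space d)) (X ν : USphere d → Space d) : Prop where
  smooth : ContMDiff (𝓡 d) 𝓘(ℝ, Space d) ∞ X
  isEmbedding : Topology.IsEmbedding X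
  immersion : ∀ u, Function.Injective (mfderiv (𝓡 d) 𝓘(ℝ, Space d) X u)
  range_eq : Set.range X = frontier K
  norm_normal : ∀ u, ‖ν u‖ = 1
  outer_normal : ∀ u, ∀ x ∈ K, inner ℝ (x - X u) (ν u) ≤ 0
  curvature_pos : ∀ u, 0 < gaussCurvature X ν u

/-- A convex body (compact convex set) with the origin in its interior. -/
structure IsCenteredBody (K : Set (Space d)) : Prop where
  compact : IsCompact K
  convex : Convex ℝ K
  zero_mem : (0 : Space d) ∈ interior K

/-- The class of smooth convex bodies in `ℝ^{d+1}` that contain the origin in their interior and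
have positive Gauss curvature at all boundary points. -/
def SmoothBodies (d : ℕ) : Set (Set (Space d)) :=
  {K | IsCenteredBody K ∧ ∃ X ν : USphere d → Space d, IsBoundaryParam K X ν}

/-- Right-hand side of the `p`-flow in `ℝ^n`, `n = d + 1`:
`sgn (p/(n+p)) κ₀^{n(p-1)/((n+1)(n+p))} 𝒩`. -/
def flowVelocity (p : ℝ) (X ν : USphere d → Space d) (u : USphere d) : Space d :=
  (Real.sign (p / ((d : ℝ) + 1 + p)) *
    centroAffineCurvature X ν u ^
      ((((d : ℝ) + 1) * (p - 1)) / (((d : ℝ) + 2) * ((d : ℝ) + 1 + p)))) • affineNormal X ν u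

/-- `X : [0,T) × 𝕊^{n-1} → ℝ^n` is a smooth solution of the `p`-flow among smooth convex bodies, with
initial body `K₀`; `K t` is the body at time `t` and `ν t u` its outer unit normal at `X t u`. At time
`0` the parametrization is that of `∂K₀` by its outer unit normal. -/
structure IsFlowSolution (p T : ℝ) (K₀ : Set (Space d)) (K : ℝ → Set (Space d))
    (X ν : ℝ → USphere d → Space d) : Prop where
  smooth : ContMDiffOn ((𝓡 d).prod 𝓘(ℝ, ℝ)) 𝓘(ℝ, Space d) ∞
    (fun q : USphere d × ℝ => X q.2 q.1) (Set.univ ×ˢ Set.Ico 0 T)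
  body : ∀ t ∈ Set.Ico 0 T, IsCenteredBody (K t)
  param : ∀ t ∈ Set.Ico 0 T, IsBoundaryParam (K t) (X t) (ν t)
  evolution : ∀ t ∈ Set.Ico 0 T, ∀ u,
    HasDerivWithinAt (fun s => X s u) (flowVelocity p (X t) (ν t) u) (Set.Ico 0 T) t
  initial_body : K 0 = K₀
  initial_normal : ∀ u : USphere d, ν 0 u = u

/-- `K t`, `0 ≤ t < T`, is the family of bodies moved by some solution of the `p`-flow that starts
from `K₀`. -/
def FlowsTo (p T : ℝ) (K₀ : Set (Space d)) (K : ℝ → Set (Space d)) : Prop :=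
  ∃ X ν : ℝ → USphere d → Space d, IsFlowSolution p T K₀ K X ν

end Global

end CentroAffine

end

/-! Put `n = d + 1`, `a = p / (n + p)`, and let `h = X · ν`. The Christoffel terms in the affine
normal are tangential, so the normal speed of the flow is `-sgn(a) κ₀ ^ a h`. As `y ↦ sgn(a) y ^ a`
is nondecreasing on `y > 0`, a larger centro-affine curvature never moves the boundary outwards
faster at equal `h`; this is the parabolicity behind the comparison.

The inner body `K t` is compared with the dilate `μ t • K' t` of the outer one, `μ t = exp (ε * exp
(L * t))`, which at time `0` contains it strictly. Suppose they touch for the first time at `t₀`,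
with common normal `v`. Second order comparison gives `κ₀' ≤ μ ^ (2 * n) κ₀`
(`centroAffineCurvature_le_of_touching`). With `s = log μ ≤ 1` the gap `⟨X, v⟩ - μ ⟨X', v⟩` then has
time derivative `μ h' (sgn(a) (κ₀' ^ a - κ₀ ^ a) - L s)`. The difference of powers is at most a
constant times `s` (`sign_mul_rpow_sub_rpow_le`), and the constant depends only on `n`, `a` and a
bound for `κ₀' ^ a` on the time interval (`exists_rpow_curvature_le`). For large `L` the derivative
is negative, but a gap that was negative before `t₀` and is nonnegative at `t₀` cannot have it
(`exists_inner_lt_exp`). Letting `ε → 0` gives the containment.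

Support functions enter only through inequalities between inner products with boundary points, so
their regularity is never needed. -/

namespace CentroAffine

open Filter Topology Matrix

/-! ### Monotonicity of determinants of positive matrices -/

section Determinants

variable {m : Type*} [Fintype m] [DecidableEq m]

theorem one_le_det_one_add_of_posSemidef {S : Matrix m m ℝ} (hS : S.PosSemidef) :
    1 ≤ (1 + S).det := by
  have hH : (1 + S).IsHermitian := (Matrix.PosSemidef.one.add hS).1
  rw [hH.det_eq_prod_eigenvalues]
  refine Finset.one_le_prod fun i _ => ?_
  have hv : (star (hH.eigenvectorBasis i).ofLp) ⬝ᵥ (hH.eigenvectorBasis i).ofLp = 1 := by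
    have h := hH.eigenvectorBasis.orthonormal.1 i
    have h2 := real_inner_self_eq_norm_sq (hH.eigenvectorBasis i)
    rw [h, EuclideanSpace.inner_eq_star_dotProduct, dotProduct_comm] at h2
    simpa using h2
  have hpos := hS.dotProduct_mulVec_nonneg (hH.eigenvectorBasis i).ofLp
  rw [hH.eigenvalues_eq, Matrix.add_mulVec, Matrix.one_mulVec, dotProduct_add, hv]
  simpa using hpos

/-- Factoring `B = Cᴴ * C` with `C` invertible turns `P` into `Cᴴ * (1 + S) * C` with `S` positive
semidefinite, and `1 + S` has all eigenvalues at least `1`. -/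
theorem det_le_det_of_posSemidef_sub {P B : Matrix m m ℝ} (hB : B.PosDef)
    (hPB : (P - B).PosSemidef) : B.det ≤ P.det := by
  open scoped MatrixOrder in
  obtain ⟨C, hC⟩ := CStarAlgebra.nonneg_iff_eq_star_mul_self.mp
    (Matrix.nonneg_iff_posSemidef.mpr hB.posSemidef)
  rw [Matrix.star_eq_conjTranspose] at hC
  have hdet : B.det = C.det * C.det := by
    rw [hC, Matrix.det_mul, Matrix.det_conjTranspose]; simp
  have hCu : IsUnit C.det := by
    rw [isUnit_iff_ne_zero]
    intro h
    have := hB.det_pos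
    simp [hdet, h] at this
  have hS := hPB.conjTranspose_mul_mul_same C⁻¹
  have key : P = Cᴴ * (1 + C⁻¹ᴴ * (P - B) * C⁻¹) * C := by
    have h1 : C⁻¹ * C = 1 := Matrix.nonsing_inv_mul _ hCu
    have h2 : Cᴴ * C⁻¹ᴴ = 1 := by
      rw [← Matrix.conjTranspose_mul, h1, Matrix.conjTranspose_one]
    calc P = B + (P - B) := by abel
      _ = Cᴴ * C + (Cᴴ * C⁻¹ᴴ) * (P - B) * (C⁻¹ * C) := by rw [h1, h2, ← hC]; simp
      _ = _ := by noncomm_ring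
  rw [key, Matrix.det_mul, Matrix.det_mul, Matrix.det_conjTranspose, hdet]
  have h1 := one_le_det_one_add_of_posSemidef hS
  simp only [star_trivial]
  nlinarith [mul_self_nonneg C.det]

theorem mul_pow_det_le_det_of_posSemidef_sub {P Q A : Matrix m m ℝ} {c : ℝ} (hc : 0 < c)
    (hP : P.PosSemidef) (hQ : Q.PosDef) (hPQ : (P - c • (Aᵀ * Q * A)).PosSemidef) :
    c ^ Fintype.card m * (A.det ^ 2 * Q.det) ≤ P.det := by
  by_cases hA : A.det = 0
  · simpa [hA] using hP.det_nonneg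
  have hinj : Function.Injective A.mulVec :=
    Matrix.mulVec_injective_iff_isUnit.mpr
      ((Matrix.isUnit_iff_isUnit_det A).mpr (isUnit_iff_ne_zero.mpr hA))
  have hB : (c • (Aᵀ * Q * A)).PosDef := by
    have := hQ.conjTranspose_mul_mul_same hinj
    rw [Matrix.conjTranspose_eq_transpose_of_trivial] at this
    exact this.smul hc
  have h := det_le_det_of_posSemidef_sub hB hPQ
  rw [Matrix.det_smul, Matrix.det_mul, Matrix.det_mul, Matrix.det_transpose] at h
  linarith

end Determinants

/-! ### Second order Taylor limit of a curve -/

section SecondOrder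

variable {E : Type*} [NormedAddCommGroup E] [NormedSpace ℝ E]

/-- The mean value inequality applied to `γ x - (x ^ 2 / 2) • D`, whose derivative `γ' x - x • D` is
`o(x)`. Only differentiability of `γ'` at the single point `0` is needed. -/
theorem tendsto_inv_sq_smul_of_hasDerivAt {γ γ' : ℝ → E} {D : E}
    (h1 : ∀ᶠ s in 𝓝 (0 : ℝ), HasDerivAt γ (γ' s) s) (h2 : HasDerivAt γ' D 0)
    (hγ : γ 0 = 0) (hγ' : γ' 0 = 0) :
    Tendsto (fun s : ℝ => (s ^ 2)⁻¹ • γ s) (𝓝[≠] 0) (𝓝 ((1 / 2 : ℝ) • D)) := by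
  rw [tendsto_iff_norm_sub_tendsto_zero, Metric.tendsto_nhds]
  intro ε hε
  have h3 : ∀ᶠ s in 𝓝 (0 : ℝ), ‖γ' s - s • D‖ ≤ ε / 2 * ‖s‖ := by
    have := h2.isLittleO.def (half_pos hε)
    simpa [hγ'] using this
  obtain ⟨r, hr, hball⟩ := Metric.eventually_nhds_iff_ball.mp (h1.and h3)
  filter_upwards [self_mem_nhdsWithin, nhdsWithin_le_nhds (Metric.ball_mem_nhds 0 hr)]
    with s hs0 hs
  have hs0 : s ≠ 0 := hs0
  have hsr : |s| < r := by simpa using hs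
  have hmem : ∀ x ∈ Set.uIcc 0 s, |x| ≤ |s| := by
    intro x hx
    have := Set.abs_sub_left_of_mem_uIcc hx
    simpa using this
  have hd : ∀ x ∈ Set.uIcc 0 s, HasDerivWithinAt (fun x => γ x - (x ^ 2 / 2) • D)
      (γ' x - x • D) (Set.uIcc 0 s) x := by
    intro x hx
    have hx' := (hball x (by simpa using (hmem x hx).trans_lt hsr)).1
    have h4 : HasDerivAt (fun x : ℝ => x ^ 2 / 2) x x := by
      simpa using (hasDerivAt_pow 2 x).div_const 2
    exact (hx'.sub (h4.smul_const D)).hasDerivWithinAt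
  have hb : ∀ x ∈ Set.uIcc 0 s, ‖γ' x - x • D‖ ≤ ε / 2 * |s| := by
    intro x hx
    refine ((hball x (by simpa using (hmem x hx).trans_lt hsr)).2).trans ?_
    have := hmem x hx
    rw [Real.norm_eq_abs]
    gcongr
  have := (convex_uIcc 0 s).norm_image_sub_le_of_norm_hasDerivWithin_le hd hb
    Set.left_mem_uIcc Set.right_mem_uIcc
  simp only [hγ, sub_zero, Real.norm_eq_abs] at this
  have hs2 : 0 < s ^ 2 := by positivity
  have heq : (s ^ 2)⁻¹ • γ s - (1 / 2 : ℝ) • D = (s ^ 2)⁻¹ • (γ s - (s ^ 2 / 2) • D) := by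
    rw [smul_sub, smul_smul]
    congr 2
    field_simp
  rw [heq, norm_smul, norm_inv, Real.norm_of_nonneg hs2.le, dist_zero_right, norm_mul, norm_inv,
    Real.norm_of_nonneg hs2.le, norm_norm, inv_mul_lt_iff₀ hs2]
  simp only [ne_eq, OfNat.ofNat_ne_zero, not_false_eq_true, zero_pow, zero_div, zero_smul,
    sub_zero] at this
  have h5 : ε / 2 * |s| * |s| = ε / 2 * s ^ 2 := by rw [mul_assoc, abs_mul_abs_self]; ring
  rw [h5] at this
  nlinarith

end SecondOrder

/-! ### Curvature comparison and the affine normal in local coordinates -/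

section LocalGeometry

variable {d : ℕ}

theorem fderiv_apply_eq_sum_pd {F : Type*} [NormedAddCommGroup F] [NormedSpace ℝ F]
    (f : Coord d → F) (y ξ : Coord d) : fderiv ℝ f y ξ = ∑ i, ξ i • pd i f y := by
  conv_lhs => rw [← (EuclideanSpace.basisFun (Fin d) ℝ).sum_repr ξ]
  simp [pd]

theorem pd_pd_eq {F : Type*} [NormedAddCommGroup F] [NormedSpace ℝ F] {f : Coord d → F}
    {y : Coord d} (hf : ContDiffAt ℝ 2 f y) (i j : Fin d) :
    pd i (pd j f) y =
      fderiv ℝ (fderiv ℝ f) y (EuclideanSpace.single i 1) (EuclideanSpace.single j 1) := by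
  have h : DifferentiableAt ℝ (fderiv ℝ f) y :=
    (hf.fderiv_right (m := 1) (by norm_num)).differentiableAt (by norm_num)
  unfold pd
  rw [fderiv_clm_apply h (differentiableAt_const _)]
  simp

theorem secondForm_apply {Y N : Coord d → Space d} {y : Coord d} (hY : ContDiffAt ℝ 2 Y y)
    (i j : Fin d) : secondForm Y N y i j = - inner ℝ (fderiv ℝ (fderiv ℝ Y) y
      (EuclideanSpace.single i 1) (EuclideanSpace.single j 1)) (N y) := by
  simp [secondForm, pd_pd_eq hY]

theorem inner_sndFDeriv {Y N : Coord d → Space d} {y : Coord d} (hY : ContDiffAt ℝ 2 Y y)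
    (ξ η : Coord d) : inner ℝ (fderiv ℝ (fderiv ℝ Y) y ξ η) (N y) =
      - (ξ.ofLp ⬝ᵥ (secondForm Y N y *ᵥ η.ofLp)) := by
  conv_lhs => rw [← (EuclideanSpace.basisFun (Fin d) ℝ).sum_repr ξ,
    ← (EuclideanSpace.basisFun (Fin d) ℝ).sum_repr η]
  simp only [map_sum, _root_.sum_apply, map_smul, _root_.smul_apply,
    sum_inner, inner_smul_left, EuclideanSpace.basisFun_repr, EuclideanSpace.basisFun_apply,
    dotProduct, mulVec, secondForm_apply hY, Finset.mul_sum]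
  rw [← Finset.sum_neg_distrib, Finset.sum_comm]
  refine Finset.sum_congr rfl fun i _ => ?_
  rw [← Finset.sum_neg_distrib]
  refine Finset.sum_congr rfl fun j _ => ?_
  simp
  ring

theorem secondForm_isHermitian {Y N : Coord d → Space d} {y : Coord d}
    (hY : ContDiffAt ℝ 2 Y y) : (secondForm Y N y).IsHermitian := by
  refine Matrix.IsHermitian.ext fun i j => ?_
  rw [star_trivial, secondForm_apply hY, secondForm_apply hY,
    hY.isSymmSndFDerivAt (by simp)]

theorem firstForm_posSemidef (Y : Coord d → Space d) (y : Coord d) :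
    (firstForm Y y).PosSemidef := Matrix.posSemidef_gram ℝ _

theorem hasDerivAt_comp_line {Y : Coord d → Space d} {y : Coord d} (hY : ContDiffAt ℝ 2 Y y)
    (ξ : Coord d) :
    (∀ᶠ s in 𝓝 (0 : ℝ), HasDerivAt (fun s : ℝ => Y (y + s • ξ)) (fderiv ℝ Y (y + s • ξ) ξ) s) ∧
    HasDerivAt (fun s : ℝ => fderiv ℝ Y (y + s • ξ) ξ) (fderiv ℝ (fderiv ℝ Y) y ξ ξ) 0 := by
  have hline : ∀ s : ℝ, HasDerivAt (fun s : ℝ => y + s • ξ) ξ s := fun s => by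
    simpa using ((hasDerivAt_id s).smul_const ξ).const_add y
  have hcont : Tendsto (fun s : ℝ => y + s • ξ) (𝓝 0) (𝓝 y) := by
    simpa using (hline 0).continuousAt.tendsto
  constructor
  · have h1 : ∀ᶠ z in 𝓝 y, DifferentiableAt ℝ Y z :=
      (hY.eventually (by simp)).mono fun z hz => hz.differentiableAt (by norm_num)
    filter_upwards [hcont.eventually h1] with s hs
    exact hs.hasFDerivAt.comp_hasDerivAt s (hline s)
  · have h : DifferentiableAt ℝ (fderiv ℝ Y) y :=
      (hY.fderiv_right (m := 1) (by norm_num)).differentiableAt (by norm_num)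
    have h' : HasFDerivAt (fderiv ℝ Y) (fderiv ℝ (fderiv ℝ Y) y) (y + (0 : ℝ) • ξ) := by
      simpa using h.hasFDerivAt
    have h'' : HasDerivAt (fun s : ℝ => fderiv ℝ Y (y + s • ξ)) (fderiv ℝ (fderiv ℝ Y) y ξ) 0 :=
      h'.comp_hasDerivAt 0 (hline 0)
    simpa using h''.clm_apply (hasDerivAt_const 0 ξ)

/-- Second order comparison of two hypersurfaces that touch from one side. -/
theorem inner_sndFDeriv_le_of_touching {Y₁ Y₂ N₂ : Coord d → Space d} {y₁ y₂ : Coord d} {μ : ℝ}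
    (h₁ : ContDiffAt ℝ 2 Y₁ y₁) (h₂ : ContDiffAt ℝ 2 Y₂ y₂) (hN : ContinuousAt N₂ y₂)
    (hle : ∀ y z, inner ℝ (Y₁ y - μ • Y₂ z) (N₂ z) ≤ 0) (heq : Y₁ y₁ = μ • Y₂ y₂)
    {ξ η : Coord d} (hξ : fderiv ℝ Y₁ y₁ ξ = μ • fderiv ℝ Y₂ y₂ η) :
    inner ℝ (fderiv ℝ (fderiv ℝ Y₁) y₁ ξ ξ) (N₂ y₂) ≤
      μ * inner ℝ (fderiv ℝ (fderiv ℝ Y₂) y₂ η η) (N₂ y₂) := by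
  obtain ⟨a1, a2⟩ := hasDerivAt_comp_line h₁ ξ
  obtain ⟨b1, b2⟩ := hasDerivAt_comp_line h₂ η
  have hlim := tendsto_inv_sq_smul_of_hasDerivAt
    (γ := fun s : ℝ => Y₁ (y₁ + s • ξ) - μ • Y₂ (y₂ + s • η))
    (γ' := fun s : ℝ => fderiv ℝ Y₁ (y₁ + s • ξ) ξ - μ • fderiv ℝ Y₂ (y₂ + s • η) η)
    (by filter_upwards [a1, b1] with s hs1 hs2 using hs1.sub (hs2.const_smul μ))
    (a2.sub (b2.const_smul μ)) (by simp [heq]) (by simp [hξ])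
  have hline : Tendsto (fun s : ℝ => y₂ + s • η) (𝓝[≠] 0) (𝓝 y₂) := by
    have : Continuous fun s : ℝ => y₂ + s • η := by fun_prop
    simpa using (this.tendsto 0).mono_left nhdsWithin_le_nhds
  -- The normal is taken at the moving point of the second surface, where `hle` has its sign. The
  -- difference of the curves is already of order `s ^ 2`, so continuity of `N₂` suffices in the
  -- limit.
  have hN' := hN.tendsto.comp hline
  have hlim2 := hlim.inner (𝕜 := ℝ) hN'
  have hle0 := le_of_tendsto hlim2 (b := 0) (Eventually.of_forall fun s => by
    simp only [Function.comp_apply, inner_smul_left]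
    exact mul_nonpos_of_nonneg_of_nonpos (by simp; positivity) (hle _ _))
  simp only [inner_smul_left, inner_sub_left] at hle0
  simp at hle0
  linarith

/-- The second fundamental form at a point where a linear function attains its maximum. -/
theorem secondForm_posSemidef {Y N : Coord d → Space d} {y : Coord d} (hY : ContDiffAt ℝ 2 Y y)
    (htan : ∀ ξ, inner ℝ (fderiv ℝ Y y ξ) (N y) = 0)
    (hmax : ∀ z, inner ℝ (Y z - Y y) (N y) ≤ 0) : (secondForm Y N y).PosSemidef := by
  refine Matrix.PosSemidef.of_dotProduct_mulVec_nonneg (secondForm_isHermitian hY) fun x => ?_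
  obtain ⟨a1, a2⟩ := hasDerivAt_comp_line hY (WithLp.toLp 2 x)
  have a3 := (hasDerivAt_const (0 : ℝ) (fderiv ℝ Y y (WithLp.toLp 2 x)))
  have hlim := tendsto_inv_sq_smul_of_hasDerivAt
    (γ := fun s : ℝ => Y (y + s • WithLp.toLp 2 x) - Y y - s • fderiv ℝ Y y (WithLp.toLp 2 x))
    (γ' := fun s : ℝ => fderiv ℝ Y (y + s • WithLp.toLp 2 x) (WithLp.toLp 2 x)
      - fderiv ℝ Y y (WithLp.toLp 2 x))
    (by
      filter_upwards [a1] with s hs1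
      exact ((hs1.sub_const (Y y)).sub ((hasDerivAt_id s).smul_const _)).congr_deriv (by simp))
    (a2.sub_const _) (by simp) (by simp)
  have hlim2 := hlim.inner (𝕜 := ℝ) (tendsto_const_nhds (x := N y))
  have hle0 := le_of_tendsto hlim2 (b := 0) (Eventually.of_forall fun s => by
    rw [inner_smul_left, inner_sub_left _ (s • _), inner_smul_left, htan, mul_zero, sub_zero]
    exact mul_nonpos_of_nonneg_of_nonpos (by simp; positivity) (hmax _))
  rw [inner_smul_left, inner_sndFDeriv hY] at hle0
  simp only [star_trivial]
  simp at hle0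
  linarith

theorem range_fderiv_eq_orthogonal {Y : Coord d → Space d} {y : Coord d} {v : Space d}
    (hv : v ≠ 0) (hinj : Function.Injective (fderiv ℝ Y y))
    (htan : ∀ ξ, inner ℝ (fderiv ℝ Y y ξ) v = 0) :
    LinearMap.range (fderiv ℝ Y y).toLinearMap = (ℝ ∙ v)ᗮ := by
  apply Submodule.eq_of_le_of_finrank_eq
  · rintro _ ⟨ξ, rfl⟩
    rw [Submodule.mem_orthogonal_singleton_iff_inner_left]
    exact htan ξ
  · rw [LinearMap.finrank_range_of_inj hinj, finrank_euclideanSpace_fin]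
    have := Fact.mk (finrank_euclideanSpace_fin (𝕜 := ℝ) (n := d + 1))
    exact (Submodule.finrank_orthogonal_span_singleton hv).symm

/-- If one hypersurface lies inside a homothetic copy of another one and touches it, then its Gauss
curvature at the point of contact is at least that of the copy. -/
theorem localGaussCurvature_le_of_touching {Y₁ N₁ Y₂ N₂ : Coord d → Space d} {y₁ y₂ : Coord d}
    {μ : ℝ} (hμ : 0 < μ) (h₁ : ContDiffAt ℝ 2 Y₁ y₁) (h₂ : ContDiffAt ℝ 2 Y₂ y₂)
    (hN : ContinuousAt N₂ y₂) (hN12 : N₁ y₁ = N₂ y₂) (hN0 : N₂ y₂ ≠ 0)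
    (hle : ∀ y z, inner ℝ (Y₁ y - μ • Y₂ z) (N₂ z) ≤ 0) (heq : Y₁ y₁ = μ • Y₂ y₂)
    (hinj₁ : Function.Injective (fderiv ℝ Y₁ y₁)) (hinj₂ : Function.Injective (fderiv ℝ Y₂ y₂))
    (htan₁ : ∀ ξ, inner ℝ (fderiv ℝ Y₁ y₁ ξ) (N₁ y₁) = 0)
    (htan₂ : ∀ ξ, inner ℝ (fderiv ℝ Y₂ y₂ ξ) (N₂ y₂) = 0)
    (hsnd₁ : (secondForm Y₁ N₁ y₁).PosSemidef) (hsnd₂ : (secondForm Y₂ N₂ y₂).PosSemidef)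
    (hK₁ : 0 < localGaussCurvature Y₁ N₁ y₁) (hK₂ : 0 < localGaussCurvature Y₂ N₂ y₂) :
    localGaussCurvature Y₂ N₂ y₂ ≤ μ ^ d * localGaussCurvature Y₁ N₁ y₁ := by
  have hrange : LinearMap.range (fderiv ℝ Y₁ y₁).toLinearMap =
      LinearMap.range (fderiv ℝ Y₂ y₂).toLinearMap := by
    rw [range_fderiv_eq_orthogonal hN0 hinj₂ htan₂,
      range_fderiv_eq_orthogonal (hN12 ▸ hN0) hinj₁ htan₁, hN12]
  have hex : ∀ i, ∃ a : Coord d, fderiv ℝ Y₂ y₂ a = pd i Y₁ y₁ := fun i => by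
    have : pd i Y₁ y₁ ∈ LinearMap.range (fderiv ℝ Y₁ y₁).toLinearMap := ⟨_, rfl⟩
    rw [hrange] at this
    exact this
  choose a ha using hex
  -- The columns are the coordinates of `∂ᵢY₁` in the frame `∂ₖY₂` of the common tangent space. The
  -- frame is not scaled by `μ`, so first forms are congruent without a factor and `μ` enters only
  -- through the second forms.
  let A : Matrix (Fin d) (Fin d) ℝ := Matrix.of fun k i => a i k
  have hpd : ∀ i, pd i Y₁ y₁ = ∑ k, A k i • pd k Y₂ y₂ := fun i => by
    rw [← ha i, fderiv_apply_eq_sum_pd]; rfl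
  have hfirst : firstForm Y₁ y₁ = Aᵀ * firstForm Y₂ y₂ * A := by
    ext i j
    simp only [firstForm, Matrix.of_apply, hpd, sum_inner, inner_sum, inner_smul_left,
      inner_smul_right, Matrix.mul_apply, Matrix.transpose_apply, Finset.sum_mul]
    refine Finset.sum_congr rfl fun k _ => ?_
    rw [Finset.mul_sum]
    refine Finset.sum_congr rfl fun l _ => ?_
    simp
    ring
  have hsub : (secondForm Y₁ N₁ y₁ - μ⁻¹ • (Aᵀ * secondForm Y₂ N₂ y₂ * A)).PosSemidef := by
    refine Matrix.PosSemidef.of_dotProduct_mulVec_nonneg ?_ fun x => ?_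
    · refine hsnd₁.1.sub ?_
      have := hsnd₂.conjTranspose_mul_mul_same A
      rw [Matrix.conjTranspose_eq_transpose_of_trivial] at this
      exact (this.smul (inv_nonneg.mpr hμ.le)).1
    -- The direction `μ⁻¹ • A x` makes the curves on `Y₁` and `μ • Y₂` agree to first order. The
    -- second form is quadratic in it, so `μ * μ⁻¹ ^ 2` leaves the factor `μ⁻¹` of the claim.
    · have hξ : fderiv ℝ Y₁ y₁ (WithLp.toLp 2 x) =
          μ • fderiv ℝ Y₂ y₂ (WithLp.toLp 2 (μ⁻¹ • (A *ᵥ x))) := by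
        rw [← map_smul, ← WithLp.toLp_smul, smul_smul, mul_inv_cancel₀ hμ.ne', one_smul,
          fderiv_apply_eq_sum_pd, fderiv_apply_eq_sum_pd]
        simp only [hpd, Finset.smul_sum, mulVec, dotProduct, Finset.sum_smul, smul_smul]
        rw [Finset.sum_comm]
        refine Finset.sum_congr rfl fun k _ => Finset.sum_congr rfl fun l _ => ?_
        rw [mul_comm]
      have h := inner_sndFDeriv_le_of_touching h₁ h₂ hN hle heq hξ
      rw [inner_sndFDeriv h₂, ← hN12, inner_sndFDeriv h₁] at h
      simp only [star_trivial, Matrix.sub_mulVec, dotProduct_sub, Matrix.smul_mulVec,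
        dotProduct_smul, smul_eq_mul]
      simp only [Matrix.mulVec_smul, smul_dotProduct, dotProduct_smul, smul_eq_mul] at h
      have h3 : x ⬝ᵥ ((Aᵀ * secondForm Y₂ N₂ y₂ * A) *ᵥ x) =
          (A *ᵥ x) ⬝ᵥ (secondForm Y₂ N₂ y₂ *ᵥ (A *ᵥ x)) := by
        rw [← Matrix.mulVec_mulVec, ← Matrix.mulVec_mulVec, Matrix.dotProduct_mulVec,
          Matrix.vecMul_transpose]
      rw [h3]
      have h4 : μ * -(μ⁻¹ * (μ⁻¹ * ((A *ᵥ x) ⬝ᵥ (secondForm Y₂ N₂ y₂ *ᵥ (A *ᵥ x))))) =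
        -(μ⁻¹ * ((A *ᵥ x) ⬝ᵥ (secondForm Y₂ N₂ y₂ *ᵥ (A *ᵥ x)))) := by
        field_simp
      linarith
  have hdet₁ : (firstForm Y₁ y₁).det ≠ 0 := fun h => by
    simp [localGaussCurvature, h] at hK₁
  have hdet₂ : (firstForm Y₂ y₂).det ≠ 0 := fun h => by
    simp [localGaussCurvature, h] at hK₂
  have hdets₂ : (secondForm Y₂ N₂ y₂).det ≠ 0 := fun h => by
    simp [localGaussCurvature, h] at hK₂
  have hcmp := mul_pow_det_le_det_of_posSemidef_sub (inv_pos.mpr hμ) hsnd₁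
    (hsnd₂.posDef_iff_det_ne_zero.mpr hdets₂) hsub
  have hd1 : (firstForm Y₁ y₁).det = A.det ^ 2 * (firstForm Y₂ y₂).det := by
    rw [hfirst, Matrix.det_mul, Matrix.det_mul, Matrix.det_transpose]; ring
  have hAne : A.det ≠ 0 := fun h => hdet₁ (by rw [hd1, h]; simp)
  have hp2 : 0 < (firstForm Y₂ y₂).det :=
    lt_of_le_of_ne (firstForm_posSemidef Y₂ y₂).det_nonneg hdet₂.symm
  have hA2 : 0 < A.det ^ 2 := by positivity
  rw [Fintype.card_fin, inv_pow, inv_mul_le_iff₀ (by positivity)] at hcmp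
  unfold localGaussCurvature
  rw [hd1, mul_div_assoc', div_le_div_iff₀ hp2 (by positivity)]
  calc (secondForm Y₂ N₂ y₂).det * (A.det ^ 2 * (firstForm Y₂ y₂).det)
      = (A.det ^ 2 * (secondForm Y₂ N₂ y₂).det) * (firstForm Y₂ y₂).det := by ring
    _ ≤ _ := by gcongr

/-- The affine normal has normal component `-𝒦^{1/(n+1)}`. -/
theorem inner_localAffineNormal {Y N : Coord d → Space d} {y : Coord d} (hd : 1 ≤ d)
    (htan : ∀ ξ, inner ℝ (fderiv ℝ Y y ξ) (N y) = 0) (hK : 0 < localGaussCurvature Y N y)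
    (hsymm : (secondForm Y N y).IsHermitian) :
    inner ℝ (localAffineNormal Y N y) (N y) =
      -(localGaussCurvature Y N y ^ (1 / ((d : ℝ) + 2))) := by
  have hdet : (secondForm Y N y).det ≠ 0 := fun h => by
    simp [localGaussCurvature, h] at hK
  have hpd : ∀ k, inner ℝ (pd k Y y) (N y) = 0 := fun k => htan _
  set c := localGaussCurvature Y N y ^ (-1 / ((d : ℝ) + 2)) with hc
  have hcpos : 0 < c := Real.rpow_pos_of_pos hK _
  have hcinv : c⁻¹ = localGaussCurvature Y N y ^ (1 / ((d : ℝ) + 2)) := by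
    rw [hc, ← Real.rpow_neg hK.le]; congr 1; ring
  have hg : blaschkeMetric Y N y = c • secondForm Y N y := rfl
  have hginv : (blaschkeMetric Y N y)⁻¹ = c⁻¹ • (secondForm Y N y)⁻¹ := by
    rw [hg]
    apply Matrix.inv_eq_left_inv
    rw [Matrix.smul_mul, Matrix.mul_smul, smul_smul, inv_mul_cancel₀ hcpos.ne', one_smul,
      Matrix.nonsing_inv_mul _ (isUnit_iff_ne_zero.mpr hdet)]
  have hsum : ∑ i, ∑ j, (secondForm Y N y)⁻¹ i j * secondForm Y N y i j = d := by
    have h1 : ((secondForm Y N y)⁻¹ * secondForm Y N y).trace = d := by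
      rw [Matrix.nonsing_inv_mul _ (isUnit_iff_ne_zero.mpr hdet)]; simp
    rw [← h1]
    simp only [Matrix.trace, Matrix.diag, Matrix.mul_apply]
    refine Finset.sum_congr rfl fun i _ => Finset.sum_congr rfl fun j _ => ?_
    rw [← hsymm.apply i j, star_trivial]
  have hterm : ∀ i j, inner ℝ ((blaschkeMetric Y N y)⁻¹ i j • (pd i (pd j Y) y -
      ∑ k, christoffel (blaschkeMetric Y N) i j k y • pd k Y y)) (N y) =
      -(c⁻¹ * ((secondForm Y N y)⁻¹ i j * secondForm Y N y i j)) := by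
    intro i j
    rw [inner_smul_left, inner_sub_left, sum_inner]
    simp only [inner_smul_left, hpd, hginv, Matrix.smul_apply]
    simp [secondForm]
    ring
  rw [localAffineNormal, laplaceBeltrami, inner_smul_left, sum_inner]
  simp only [sum_inner, hterm, Finset.sum_neg_distrib, ← Finset.mul_sum, hsum, hcinv]
  have : (d : ℝ) ≠ 0 := by positivity
  simp
  field_simp

end LocalGeometry

/-! ### Regularity of maps read in stereographic charts -/

section Charts

variable {d : ℕ}

theorem inChart_chartAt (f : USphere d → Space d) (u : USphere d) :
    inChart f u (chartAt (Coord d) u u) = f u := by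
  simp [inChart]

theorem contDiffAt_inChart {X : USphere d → Space d}
    (hX : ContMDiff (𝓡 d) 𝓘(ℝ, Space d) ∞ X) (u : USphere d) :
    ContDiffAt ℝ ∞ (inChart X u) (chartAt (Coord d) u u) := by
  have h := (contMDiffAt_iff.mp (hX u)).2
  rw [ModelWithCorners.range_eq_univ, contDiffWithinAt_univ] at h
  exact h

theorem fderiv_inChart_injective {X : USphere d → Space d}
    (hX : ContMDiff (𝓡 d) 𝓘(ℝ, Space d) ∞ X) {u : USphere d}
    (h : Function.Injective (mfderiv (𝓡 d) 𝓘(ℝ, Space d) X u)) :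
    Function.Injective (fderiv ℝ (inChart X u) (chartAt (Coord d) u u)) := by
  have h1 : mfderiv (𝓡 d) 𝓘(ℝ, Space d) X u =
      fderiv ℝ (inChart X u) (chartAt (Coord d) u u) := by
    rw [((hX u).mdifferentiableAt (by simp)).mfderiv, ModelWithCorners.range_eq_univ,
      fderivWithin_univ]
    rfl
  rw [h1] at h
  exact h

theorem continuousAt_inChart {f : USphere d → Space d} (hf : Continuous f) (u : USphere d) :
    ContinuousAt (inChart f u) (chartAt (Coord d) u u) :=
  hf.continuousAt.comp
    ((chartAt (Coord d) u).continuousAt_symm (mem_chart_target (Coord d) u))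

end Charts

/-! ### Normals, strict convexity and curvature of smooth bodies -/

section Bodies

variable {d : ℕ} {K : Set (Space d)} {X ν : USphere d → Space d}

theorem mem_frontier_of_inner_le {x v : Space d} (hv : v ≠ 0) (hx : x ∈ K)
    (h : ∀ z ∈ K, inner ℝ z v ≤ inner ℝ x v) : x ∈ frontier K := by
  refine ⟨subset_closure hx, fun hint => ?_⟩
  have hc : Tendsto (fun s : ℝ => x + s • v) (𝓝[>] 0) (𝓝 x) := by
    have : Continuous fun s : ℝ => x + s • v := by fun_prop
    simpa using (this.tendsto 0).mono_left nhdsWithin_le_nhds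
  obtain ⟨s, hs, hs0⟩ := ((hc.eventually (mem_interior_iff_mem_nhds.mp hint)).and
    self_mem_nhdsWithin).exists
  have h1 := h _ hs
  rw [inner_add_left, inner_smul_left, real_inner_self_eq_norm_sq] at h1
  have hs0 : 0 < s := hs0
  have : 0 < s * ‖v‖ ^ 2 := by positivity
  simp at h1
  linarith

theorem IsBoundaryParam.mem (hB : IsCenteredBody K) (h : IsBoundaryParam K X ν) (u : USphere d) :
    X u ∈ K := by
  have : X u ∈ frontier K := h.range_eq ▸ Set.mem_range_self u
  exact hB.compact.isClosed.frontier_subset this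

theorem IsBoundaryParam.exists_inner_le (hB : IsCenteredBody K) (h : IsBoundaryParam K X ν)
    {v : Space d} (hv : v ≠ 0) : ∃ w, ∀ x ∈ K, inner ℝ x v ≤ inner ℝ (X w) v := by
  obtain ⟨z, hz, hmax⟩ := hB.compact.exists_isMaxOn ⟨0, interior_subset hB.zero_mem⟩
    (f := fun x => inner ℝ x v) (by fun_prop)
  have hf : z ∈ frontier K := mem_frontier_of_inner_le hv hz fun y hy => hmax hy
  rw [← h.range_eq] at hf
  obtain ⟨w, rfl⟩ := hf
  exact ⟨w, fun x hx => hmax hx⟩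

/-- A point outside a closed convex set is strictly separated from it. Containment is thereby
reduced to inequalities between boundary points. -/
theorem IsBoundaryParam.mem_of_forall_inner_le (hB : IsCenteredBody K)
    (h : IsBoundaryParam K X ν) {x : Space d}
    (hx : ∀ v : Space d, ‖v‖ = 1 → ∃ w, inner ℝ x v ≤ inner ℝ (X w) v) : x ∈ K := by
  by_contra hxK
  obtain ⟨f, s, hfs, hsx⟩ := geometric_hahn_banach_closed_point hB.convex hB.compact.isClosed hxK
  set a := (InnerProductSpace.toDual ℝ (Space d)).symm f with ha
  have hfa : ∀ z, f z = inner ℝ z a := fun z => by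
    rw [real_inner_comm, ha, InnerProductSpace.toDual_symm_apply]
  have ha0 : a ≠ 0 := by
    intro h0
    have h1 := hfs 0 (interior_subset hB.zero_mem)
    rw [hfa, h0, inner_zero_right] at hsx
    rw [hfa, h0, inner_zero_right] at h1
    linarith
  obtain ⟨w, hw⟩ := hx (‖a‖⁻¹ • a) (norm_smul_inv_norm ha0)
  rw [inner_smul_right, inner_smul_right] at hw
  have hw' := le_of_mul_le_mul_left hw (inv_pos.mpr (norm_pos_iff.mpr ha0))
  rw [← hfa, ← hfa] at hw'
  linarith [hfs _ (h.mem hB w)]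

theorem IsBoundaryParam.inner_le (hB : IsCenteredBody K) (h : IsBoundaryParam K X ν)
    {v : Space d} (hv : ‖v‖ = 1) {u : USphere d} (hmax : ∀ w, inner ℝ (X w) v ≤ inner ℝ (X u) v)
    {x : Space d} (hx : x ∈ K) : inner ℝ x v ≤ inner ℝ (X u) v := by
  obtain ⟨w, hw⟩ := h.exists_inner_le hB (v := v) (by rintro rfl; simp at hv)
  exact (hw x hx).trans (hmax w)

theorem IsBoundaryParam.inner_pos (hB : IsCenteredBody K) (h : IsBoundaryParam K X ν)
    {v : Space d} (hv : ‖v‖ = 1) {u : USphere d}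
    (hmax : ∀ w, inner ℝ (X w) v ≤ inner ℝ (X u) v) : 0 < inner ℝ (X u) v := by
  have hv0 : v ≠ 0 := by rintro rfl; simp at hv
  have h0 := interior_subset hB.zero_mem
  refine lt_of_le_of_ne (by simpa using h.inner_le hB hv hmax h0) fun heq => ?_
  have : (0 : Space d) ∈ frontier K := mem_frontier_of_inner_le hv0 h0 fun z hz => by
    rw [inner_zero_left, heq]
    exact h.inner_le hB hv hmax hz
  exact this.2 hB.zero_mem

theorem IsBoundaryParam.inner_le_normal (hB : IsCenteredBody K) (h : IsBoundaryParam K X ν)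
    (u w : USphere d) : inner ℝ (X w) (ν u) ≤ inner ℝ (X u) (ν u) := by
  have := h.outer_normal u _ (h.mem hB w)
  rwa [inner_sub_left, sub_nonpos] at this

theorem inner_fderiv_inChart_eq_zero {v : Space d} {u : USphere d} {y : Coord d} (hy : DifferentiableAt ℝ (inChart X u) y)
    (hmax : ∀ w, inner ℝ (X w) v ≤ inner ℝ (inChart X u y) v) (ξ : Coord d) :
    inner ℝ (fderiv ℝ (inChart X u) y ξ) v = 0 := by
  have hloc : IsLocalMax (fun z => inner ℝ (inChart X u z) v) y :=
    Eventually.of_forall fun z => hmax _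
  have hz := hloc.fderiv_eq_zero
  have hd := hy.hasFDerivAt.inner ℝ (hasFDerivAt_const v y)
  rw [hd.fderiv] at hz
  simpa [real_inner_comm] using congrArg (fun f => f ξ) hz

theorem IsBoundaryParam.differentiableAt (h : IsBoundaryParam K X ν) (u : USphere d) :
    DifferentiableAt ℝ (inChart X u) (chartAt (Coord d) u u) :=
  (contDiffAt_inChart h.smooth u).differentiableAt (by simp)

theorem IsBoundaryParam.tangent (h : IsBoundaryParam K X ν) {v : Space d} {u : USphere d}
    (hmax : ∀ w, inner ℝ (X w) v ≤ inner ℝ (X u) v) (ξ : Coord d) :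
    inner ℝ (fderiv ℝ (inChart X u) (chartAt (Coord d) u u) ξ) v = 0 :=
  inner_fderiv_inChart_eq_zero (h.differentiableAt u) (by simpa [inChart_chartAt] using hmax) ξ

/-- Both vectors are orthogonal to the tangent hyperplane, hence parallel; the interior origin makes
both pair positively with `X u`, which fixes the sign. -/
theorem IsBoundaryParam.eq_normal (hB : IsCenteredBody K) (h : IsBoundaryParam K X ν)
    {v : Space d} (hv : ‖v‖ = 1) {u : USphere d}
    (hmax : ∀ w, inner ℝ (X w) v ≤ inner ℝ (X u) v) : v = ν u := by
  have hν := h.norm_normal u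
  have hinj := fderiv_inChart_injective h.smooth (h.immersion u)
  have hv0 : v ≠ 0 := by rintro rfl; simp at hv
  have hν0 : ν u ≠ 0 := fun h0 => by rw [h0] at hν; simp at hν
  have h1 := range_fderiv_eq_orthogonal hv0 hinj (h.tangent hmax)
  have h2 := range_fderiv_eq_orthogonal hν0 hinj (h.tangent (h.inner_le_normal hB u))
  have h3 : v ∈ (ℝ ∙ ν u) := by
    rw [← Submodule.orthogonal_orthogonal (ℝ ∙ ν u), ← h2, h1,
      Submodule.orthogonal_orthogonal]
    exact Submodule.mem_span_singleton_self v
  obtain ⟨c, rfl⟩ := Submodule.mem_span_singleton.mp h3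
  have p1 := h.inner_pos hB hv hmax
  have p2 := h.inner_pos hB hν (h.inner_le_normal hB u)
  rw [inner_smul_right] at p1
  have hc : 0 < c := pos_of_mul_pos_left p1 p2.le
  rw [norm_smul, hν, mul_one, Real.norm_of_nonneg hc.le] at hv
  rw [hv, one_smul]

/-- Limits of outer normals are again supporting directions, and the unit supporting direction at a
boundary point is unique, so compactness of the sphere gives continuity. -/
theorem IsBoundaryParam.continuous_normal (hB : IsCenteredBody K) (h : IsBoundaryParam K X ν) :
    Continuous ν := by
  rw [continuous_iff_continuousAt]
  intro u
  refine tendsto_of_subseq_tendsto fun ns hns => ?_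
  obtain ⟨v, hv, φ, hφ, hlim⟩ := (isCompact_sphere (0 : Space d) 1).tendsto_subseq
    (x := fun k => ν (ns k)) (fun k => by simp [h.norm_normal])
  refine ⟨φ, ?_⟩
  have hX : Tendsto (fun k => X (ns (φ k))) atTop (𝓝 (X u)) :=
    (h.smooth.continuous.tendsto u).comp (hns.comp hφ.tendsto_atTop)
  have hvν : v = ν u := by
    refine h.eq_normal hB (by simpa using hv) fun w => ?_
    refine le_of_tendsto_of_tendsto (tendsto_const_nhds.inner hlim) (hX.inner hlim)
      (Eventually.of_forall fun k => h.inner_le_normal hB _ _)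
  rw [← hvν]
  exact hlim

theorem IsBoundaryParam.det_secondForm_ne_zero (h : IsBoundaryParam K X ν) (u : USphere d) :
    (secondForm (inChart X u) (inChart ν u) (chartAt (Coord d) u u)).det ≠ 0 := fun h0 => by
  have := h.curvature_pos u
  simp [gaussCurvature, localGaussCurvature, h0] at this

theorem IsBoundaryParam.contDiffAt_two (h : IsBoundaryParam K X ν) (u : USphere d) :
    ContDiffAt ℝ 2 (inChart X u) (chartAt (Coord d) u u) :=
  contDiffAt_infty.mp (contDiffAt_inChart h.smooth u) 2

/-- The derivative of this covector field at the base point is minus the second fundamental form,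
which is nondegenerate, so its zero there is isolated. Strict convexity rests on this. -/
theorem IsBoundaryParam.eventually_inner_fderiv_ne_zero (h : IsBoundaryParam K X ν)
    (u : USphere d) : ∀ᶠ y in 𝓝[≠] (chartAt (Coord d) u u),
      (innerSL ℝ (ν u)).comp (fderiv ℝ (inChart X u) y) ≠ 0 := by
  have hY := h.contDiffAt_two u
  have hD : HasFDerivAt (fderiv ℝ (inChart X u))
      (fderiv ℝ (fderiv ℝ (inChart X u)) (chartAt (Coord d) u u)) (chartAt (Coord d) u u) :=
    ((hY.fderiv_right (m := 1) (by norm_num)).differentiableAt (by norm_num)).hasFDerivAt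
  have hG := ((ContinuousLinearMap.compL ℝ (Coord d) (Space d) ℝ
    (innerSL ℝ (ν u))).hasFDerivAt).comp (chartAt (Coord d) u u) hD
  refine hG.eventually_ne (c := 0) ?_
  suffices hker : LinearMap.ker
      ((ContinuousLinearMap.compL ℝ (Coord d) (Space d) ℝ (innerSL ℝ (ν u))).comp
        (fderiv ℝ (fderiv ℝ (inChart X u)) (chartAt (Coord d) u u))).toLinearMap = ⊥ by
    obtain ⟨C, -, hC⟩ := LinearMap.exists_antilipschitzWith _ hker
    exact ⟨C, hC⟩
  rw [LinearMap.ker_eq_bot']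
  intro ξ hξ
  have h1 : ∀ η : Coord d, ξ.ofLp ⬝ᵥ
      (secondForm (inChart X u) (inChart ν u) (chartAt (Coord d) u u) *ᵥ η.ofLp) = 0 := by
    intro η
    have h2 : inner ℝ (ν u)
      (fderiv ℝ (fderiv ℝ (inChart X u)) (chartAt (Coord d) u u) ξ η) = 0 :=
      congrArg (fun f : Coord d →L[ℝ] ℝ => f η) hξ
    rw [real_inner_comm, ← inChart_chartAt ν u, inner_sndFDeriv hY] at h2
    linarith
  have h3 : ξ.ofLp ᵥ* (secondForm (inChart X u) (inChart ν u) (chartAt (Coord d) u u)) = 0 := by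
    refine dotProduct_eq_zero _ fun w => ?_
    rw [← Matrix.dotProduct_mulVec]
    exact h1 (WithLp.toLp 2 w)
  have h4 := Matrix.eq_zero_of_vecMul_eq_zero (h.det_secondForm_ne_zero u) h3
  ext i
  exact congrFun h4 i

/-- A smooth body of positive Gauss curvature is strictly convex. -/
theorem IsBoundaryParam.eq_of_inner_eq (hB : IsCenteredBody K) (h : IsBoundaryParam K X ν)
    {v : Space d} (hv : ‖v‖ = 1) {u u' : USphere d}
    (hmax : ∀ w, inner ℝ (X w) v ≤ inner ℝ (X u) v)
    (heq : inner ℝ (X u') v = inner ℝ (X u) v) : u' = u := by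
  by_contra hne
  have hXne : X u' ≠ X u := fun h0 => hne (h.isEmbedding.injective h0)
  have hv0 : v ≠ 0 := by rintro rfl; simp at hv
  have hvν := h.eq_normal hB hv hmax
  have hex : ∀ τ : ℝ, ∃ w, τ ∈ Set.Ioc (0 : ℝ) 1 → X w = X u + τ • (X u' - X u) := by
    intro τ
    by_cases hτ : τ ∈ Set.Ioc (0 : ℝ) 1
    · have hmem : X u + τ • (X u' - X u) ∈ K :=
        hB.convex.add_smul_sub_mem (h.mem hB u) (h.mem hB u') ⟨hτ.1.le, hτ.2⟩
      have hf : X u + τ • (X u' - X u) ∈ frontier K :=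
        mem_frontier_of_inner_le hv0 hmem fun z hz => by
          rw [inner_add_left, inner_smul_left, inner_sub_left, heq]
          simpa using h.inner_le hB hv hmax hz
      rw [← h.range_eq] at hf
      obtain ⟨w, hw⟩ := hf
      exact ⟨w, fun _ => hw⟩
    · exact ⟨u, fun h0 => absurd h0 hτ⟩
  choose w hw using hex
  have hIoc : Set.Ioc (0 : ℝ) 1 ∈ 𝓝[>] (0 : ℝ) := Ioc_mem_nhdsGT one_pos
  have hwlim : Tendsto w (𝓝[>] 0) (𝓝 u) := by
    rw [h.isEmbedding.tendsto_nhds_iff]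
    have hc : Tendsto (fun τ : ℝ => X u + τ • (X u' - X u)) (𝓝[>] 0) (𝓝 (X u)) := by
      have : Continuous fun τ : ℝ => X u + τ • (X u' - X u) := by fun_prop
      simpa using (this.tendsto 0).mono_left nhdsWithin_le_nhds
    refine hc.congr' ?_
    filter_upwards [hIoc] with τ hτ using (hw τ hτ).symm
  have hsrc : ∀ᶠ τ in 𝓝[>] (0 : ℝ), w τ ∈ (chartAt (Coord d) u).source :=
    hwlim.eventually ((chartAt (Coord d) u).open_source.mem_nhds (mem_chart_source _ u))
  have hchart : Tendsto (fun τ => chartAt (Coord d) u (w τ)) (𝓝[>] 0)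
      (𝓝 (chartAt (Coord d) u u)) :=
    ((chartAt (Coord d) u).continuousAt (mem_chart_source _ u)).tendsto.comp hwlim
  have hdiff : ∀ᶠ y in 𝓝 (chartAt (Coord d) u u), DifferentiableAt ℝ (inChart X u) y :=
    ((h.contDiffAt_two u).eventually (by simp)).mono fun z hz => hz.differentiableAt (by norm_num)
  have hne' := eventually_nhdsWithin_iff.mp (h.eventually_inner_fderiv_ne_zero u)
  obtain ⟨τ, hτ, hτs, hτd, hτn⟩ := (Filter.Eventually.and hIoc
    (hsrc.and ((hchart.eventually hdiff).and (hchart.eventually hne')))).exists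
  have hwu : w τ ≠ u := fun h0 => by
    have h1 := hw τ hτ
    rw [h0, left_eq_add, smul_eq_zero, sub_eq_zero] at h1
    exact h1.elim hτ.1.ne' hXne
  refine hτn (fun h0 => hwu ((chartAt (Coord d) u).injOn hτs (mem_chart_source _ u) h0)) ?_
  have hXw : inChart X u (chartAt (Coord d) u (w τ)) = X (w τ) := by
    simp only [inChart]
    rw [(chartAt (Coord d) u).left_inv hτs]
  ext ξ
  have hzero := inner_fderiv_inChart_eq_zero (v := v) hτd (fun w' => by
    rw [hXw, hw τ hτ, inner_add_left, inner_smul_left, inner_sub_left, heq]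
    simpa using hmax w') ξ
  rw [← hvν]
  simpa [real_inner_comm] using hzero

theorem IsBoundaryParam.secondForm_posSemidef (hB : IsCenteredBody K) (h : IsBoundaryParam K X ν)
    (u : USphere d) :
    (secondForm (inChart X u) (inChart ν u) (chartAt (Coord d) u u)).PosSemidef := by
  refine CentroAffine.secondForm_posSemidef (h.contDiffAt_two u) ?_ fun z => ?_
  · rw [inChart_chartAt]
    exact h.tangent (h.inner_le_normal hB u)
  · rw [inChart_chartAt, inChart_chartAt]
    exact h.outer_normal u _ (h.mem hB _)

theorem IsBoundaryParam.inner_normal_pos (hB : IsCenteredBody K) (h : IsBoundaryParam K X ν)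
    (u : USphere d) : 0 < inner ℝ (X u) (ν u) :=
  h.inner_pos hB (h.norm_normal u) (h.inner_le_normal hB u)

theorem IsBoundaryParam.centroAffineCurvature_pos (hB : IsCenteredBody K)
    (h : IsBoundaryParam K X ν) (u : USphere d) : 0 < centroAffineCurvature X ν u :=
  div_pos (h.curvature_pos u) (pow_pos (h.inner_normal_pos hB u) _)

/-- Comparison of the centro-affine curvatures of two bodies, one of which lies in a dilate of the
other and touches its boundary. -/
theorem IsBoundaryParam.centroAffineCurvature_le_of_touching {K' : Set (Space d)}
    {X' ν' : USphere d → Space d} (hB : IsCenteredBody K) (h : IsBoundaryParam K X ν)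
    (hB' : IsCenteredBody K') (h' : IsBoundaryParam K' X' ν') {μ : ℝ} (hμ : 0 < μ)
    (hle : ∀ u w, inner ℝ (X u) (ν' w) ≤ μ * inner ℝ (X' w) (ν' w)) {u w : USphere d}
    (heq : X u = μ • X' w) :
    centroAffineCurvature X' ν' w ≤ μ ^ (2 * (d + 1)) * centroAffineCurvature X ν u := by
  have hν : ν' w = ν u := by
    refine h.eq_normal hB (h'.norm_normal w) fun z => ?_
    rw [heq, inner_smul_left]
    exact hle z w
  have hN0 : ν' w ≠ 0 := fun h0 => by
    have := h'.norm_normal w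
    rw [h0] at this
    simp at this
  have hK : gaussCurvature X' ν' w ≤ μ ^ d * gaussCurvature X ν u := by
    refine localGaussCurvature_le_of_touching hμ (h.contDiffAt_two u) (h'.contDiffAt_two w)
      (continuousAt_inChart (h'.continuous_normal hB') w) ?_ ?_ ?_ ?_
      (fderiv_inChart_injective h.smooth (h.immersion u))
      (fderiv_inChart_injective h'.smooth (h'.immersion w)) ?_ ?_ (h.secondForm_posSemidef hB u)
      (h'.secondForm_posSemidef hB' w) (h.curvature_pos u) (h'.curvature_pos w)
    · rw [inChart_chartAt, inChart_chartAt, hν]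
    · rwa [inChart_chartAt]
    · intro y z
      rw [inner_sub_left, inner_smul_left, sub_nonpos]
      exact hle _ _
    · rw [inChart_chartAt, inChart_chartAt, heq]
    · rw [inChart_chartAt]
      exact h.tangent (h.inner_le_normal hB u)
    · rw [inChart_chartAt]
      exact h'.tangent (h'.inner_le_normal hB' w)
  have hpos := h'.inner_normal_pos hB' w
  unfold centroAffineCurvature
  rw [← hν, heq, inner_smul_left, mul_pow]
  simp only [conj_trivial]
  rw [mul_div_assoc', div_le_div_iff₀ (by positivity) (by positivity)]
  calc gaussCurvature X' ν' w * (μ ^ (d + 2) * inner ℝ (X' w) (ν' w) ^ (d + 2))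
      ≤ (μ ^ d * gaussCurvature X ν u) * (μ ^ (d + 2) * inner ℝ (X' w) (ν' w) ^ (d + 2)) := by
        gcongr
    _ = _ := by ring

/-- The normal speed of the `p`-flow is `-sgn (p/(n+p)) κ₀^{p/(n+p)} h`. -/
theorem IsBoundaryParam.inner_flowVelocity (hd : 1 ≤ d) {p : ℝ} (hpn : p ≠ -((d : ℝ) + 1))
    (hB : IsCenteredBody K) (h : IsBoundaryParam K X ν) (u : USphere d) :
    inner ℝ (flowVelocity p X ν u) (ν u) =
      -(Real.sign (p / ((d : ℝ) + 1 + p)) *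
        centroAffineCurvature X ν u ^ (p / ((d : ℝ) + 1 + p))) * inner ℝ (X u) (ν u) := by
  have hN : inner ℝ (affineNormal X ν u) (ν u) =
      -(gaussCurvature X ν u ^ (1 / ((d : ℝ) + 2))) := by
    have := inner_localAffineNormal (Y := inChart X u) (N := inChart ν u)
      (y := chartAt (Coord d) u u) hd (by
        rw [inChart_chartAt]
        exact h.tangent (h.inner_le_normal hB u)) (h.curvature_pos u)
      (h.secondForm_posSemidef hB u).1
    rwa [inChart_chartAt] at this
  have hpos := h.inner_normal_pos hB u
  have hκ := h.centroAffineCurvature_pos hB u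
  have hK : gaussCurvature X ν u =
      centroAffineCurvature X ν u * inner ℝ (X u) (ν u) ^ (d + 2) := by
    unfold centroAffineCurvature
    field_simp
  have hroot : gaussCurvature X ν u ^ (1 / ((d : ℝ) + 2)) =
      centroAffineCurvature X ν u ^ (1 / ((d : ℝ) + 2)) * inner ℝ (X u) (ν u) := by
    rw [hK, Real.mul_rpow hκ.le (by positivity), ← Real.rpow_natCast, ← Real.rpow_mul hpos.le]
    congr 1
    have : ((d + 2 : ℕ) : ℝ) * (1 / ((d : ℝ) + 2)) = 1 := by push_cast; field_simp
    rw [this, Real.rpow_one]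
  have hnp : (d : ℝ) + 1 + p ≠ 0 := fun h0 => hpn (by linarith)
  have hexp : p / ((d : ℝ) + 1 + p) =
      (((d : ℝ) + 1) * (p - 1)) / (((d : ℝ) + 2) * ((d : ℝ) + 1 + p)) + 1 / ((d : ℝ) + 2) := by
    have : (d : ℝ) + 2 ≠ 0 := by positivity
    field_simp
    ring
  rw [flowVelocity, inner_smul_left, hN, hroot]
  conv_rhs => rw [hexp]
  rw [Real.rpow_add hκ, ← hexp]
  simp only [conj_trivial]
  ring

end Bodies

/-- Used with `x` the outer and `y` the inner curvature, `s = log μ` and `N = 2 * n`. Monotonicity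
of `sgn(a) y ^ a` allows replacing `y` by `x * exp (-(s * N))`; what remains is `x ^ a` times an
exponential difference, linear in `s` for `s ≤ 1`. -/
theorem sign_mul_rpow_sub_rpow_le {a x y M N s : ℝ} (hx : 0 < x)
    (hN : 0 ≤ N) (hs : 0 ≤ s) (hs1 : s ≤ 1) (hxy : x ≤ Real.exp (s * N) * y) (hM : x ^ a ≤ M) :
    Real.sign a * (x ^ a - y ^ a) ≤ M * (N * |a| * Real.exp (N * |a|)) * s := by
  set c := N * |a| with hc
  have hc0 : 0 ≤ c := by positivity
  have hxa : 0 < x ^ a := Real.rpow_pos_of_pos hx a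
  have hexp : Real.exp (c * s) ≤ Real.exp c := by
    apply Real.exp_le_exp.mpr
    nlinarith
  have hkey : Real.exp (c * s) - 1 ≤ c * Real.exp c * s := by
    have h1 := Real.add_one_le_exp (-(c * s))
    have h2 : Real.exp (-(c * s)) * Real.exp (c * s) = 1 := by
      rw [← Real.exp_add]; simp
    have h3 : Real.exp (c * s) - 1 ≤ (c * s) * Real.exp (c * s) := by
      nlinarith [Real.exp_pos (c * s)]
    have h4 : (c * s) * Real.exp (c * s) ≤ (c * s) * Real.exp c := by gcongr
    linarith
  have hkey' : 1 - Real.exp (-(c * s)) ≤ c * Real.exp c * s := by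
    have h1 := Real.add_one_le_exp (-(c * s))
    have h2 := Real.add_one_le_exp c
    have h3 : c * s * 1 ≤ c * s * Real.exp c := by gcongr; linarith
    linarith
  have hfin : x ^ a * (c * Real.exp c * s) ≤ M * (c * Real.exp c) * s := by
    rw [mul_assoc M]
    gcongr
  have hy' : x * Real.exp (-(s * N)) ≤ y := by
    rw [Real.exp_neg, ← div_eq_mul_inv, div_le_iff₀ (Real.exp_pos _)]
    linarith
  have hpow : (x * Real.exp (-(s * N))) ^ a = x ^ a * Real.exp (-(s * N) * a) := by
    rw [Real.mul_rpow hx.le (Real.exp_pos _).le, ← Real.exp_mul]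
  rcases lt_trichotomy a 0 with ha | rfl | ha
  · have h1 := Real.rpow_le_rpow_of_nonpos (by positivity) hy' ha.le
    rw [hpow] at h1
    have h2 : -(s * N) * a = c * s := by rw [hc, abs_of_neg ha]; ring
    rw [h2] at h1
    rw [Real.sign_of_neg ha]
    nlinarith
  · simp only [Real.sign_zero, zero_mul]
    have : 0 ≤ M := hxa.le.trans hM
    positivity
  · have h1 := Real.rpow_le_rpow (by positivity) hy' ha.le
    rw [hpow] at h1
    have h2 : -(s * N) * a = -(c * s) := by rw [hc, abs_of_pos ha]; ring
    rw [h2] at h1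
    rw [Real.sign_of_pos ha]
    nlinarith

/-! ### Continuity of the velocity and curvature bounds along a flow -/

section Flow

variable {d : ℕ} {p T : ℝ} {K₀ : Set (Space d)} {K : ℝ → Set (Space d)}
  {X ν : ℝ → USphere d → Space d}

theorem IsFlowSolution.contDiffOn_chart (h : IsFlowSolution p T K₀ K X ν) (u : USphere d) :
    ContDiffOn ℝ ∞ (fun q : Coord d × ℝ => X q.2 ((chartAt (Coord d) u).symm q.1))
      ((chartAt (Coord d) u).target ×ˢ Set.Ico 0 T) := by
  rw [← contMDiffOn_iff_contDiffOn]
  have h1 : ContMDiffOn 𝓘(ℝ, Coord d × ℝ) (𝓡 d) ∞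
      (fun q : Coord d × ℝ => (chartAt (Coord d) u).symm q.1)
      ((chartAt (Coord d) u).target ×ˢ Set.Ico 0 T) :=
    (contMDiffOn_chart_symm (I := 𝓡 d) (n := ∞) (x := u)).comp
      contDiff_fst.contMDiff.contMDiffOn fun q hq => hq.1
  have h2 : ContMDiffOn 𝓘(ℝ, Coord d × ℝ) 𝓘(ℝ, ℝ) ∞ (fun q : Coord d × ℝ => q.2)
      ((chartAt (Coord d) u).target ×ˢ Set.Ico 0 T) := contDiff_snd.contMDiff.contMDiffOn
  exact h.smooth.comp (h1.prodMk h2) fun q hq => ⟨Set.mem_univ _, hq.2⟩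

/-- The evolution equation identifies the velocity with the time derivative of `X`, so its
continuity follows from joint smoothness of `X` and not from the curvature formula. Derivatives
within the set include the endpoint `0`. -/
theorem IsFlowSolution.exists_velocity_chart (h : IsFlowSolution p T K₀ K X ν)
    (u : USphere d) : ∃ G : Coord d × ℝ → Space d,
      ContinuousOn G ((chartAt (Coord d) u).target ×ˢ Set.Ico 0 T) ∧
      ∀ y ∈ (chartAt (Coord d) u).target, ∀ s ∈ Set.Ico 0 T,
        flowVelocity p (X s) (ν s) ((chartAt (Coord d) u).symm y) = G (y, s) := by
  set e := chartAt (Coord d) u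
  set F := fun q : Coord d × ℝ => X q.2 (e.symm q.1)
  have hF : ContDiffOn ℝ ∞ F (e.target ×ˢ Set.Ico 0 T) := h.contDiffOn_chart u
  have huniq : UniqueDiffOn ℝ (e.target ×ˢ Set.Ico (0 : ℝ) T) :=
    e.open_target.uniqueDiffOn.prod (uniqueDiffOn_Ico 0 T)
  refine ⟨fun q => fderivWithin ℝ F (e.target ×ˢ Set.Ico 0 T) q (0, 1),
    (hF.continuousOn_fderivWithin huniq (by simp)).clm_apply continuousOn_const,
    fun y hy s hs => ?_⟩
  have h1 : HasFDerivWithinAt F _ (e.target ×ˢ Set.Ico 0 T) (y, s) :=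
    ((hF (y, s) ⟨hy, hs⟩).differentiableWithinAt (by simp)).hasFDerivWithinAt
  have h2 : HasDerivWithinAt (fun r : ℝ => (y, r)) ((0 : Coord d), (1 : ℝ)) (Set.Ico 0 T) s :=
    ((hasDerivAt_const s y).prodMk (hasDerivAt_id s)).hasDerivWithinAt
  have h3 := h1.comp_hasDerivWithinAt s h2 fun r hr => ⟨hy, hr⟩
  exact (uniqueDiffOn_Ico 0 T s hs).eq_deriv _ (h.evolution s hs (e.symm y)) h3

theorem IsFlowSolution.continuousOn_velocity (h : IsFlowSolution p T K₀ K X ν) :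
    ContinuousOn (fun q : USphere d × ℝ => flowVelocity p (X q.2) (ν q.2) q.1)
      (Set.univ ×ˢ Set.Ico 0 T) := by
  rintro ⟨u, t⟩ ⟨-, ht⟩
  have ht : t ∈ Set.Ico 0 T := ht
  obtain ⟨G, hG, heq⟩ := h.exists_velocity_chart u
  generalize hV : (fun q : USphere d × ℝ => flowVelocity p (X q.2) (ν q.2) q.1) = V
  have heq' : ∀ q : USphere d × ℝ, q ∈ (chartAt (Coord d) u).source ×ˢ Set.Ico 0 T →
      V q = G (chartAt (Coord d) u q.1, q.2) := fun q hq => by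
    rw [← heq _ ((chartAt (Coord d) u).map_source hq.1) _ hq.2,
      (chartAt (Coord d) u).left_inv hq.1, ← hV]
  clear heq hV
  have hu : u ∈ (chartAt (Coord d) u).source := mem_chart_source _ u
  have hpair : ContinuousOn (fun q : USphere d × ℝ => (chartAt (Coord d) u q.1, q.2))
      ((chartAt (Coord d) u).source ×ˢ Set.Ico 0 T) :=
    ((chartAt (Coord d) u).continuousOn.comp continuousOn_fst fun q hq => hq.1).prodMk
      continuousOn_snd
  have hcomp : ContinuousOn V ((chartAt (Coord d) u).source ×ˢ Set.Ico 0 T) :=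
    (hG.comp hpair fun q hq => ⟨(chartAt (Coord d) u).map_source hq.1, hq.2⟩).congr heq'
  refine (hcomp (u, t) ⟨hu, ht⟩).mono_of_mem_nhdsWithin ?_
  rw [nhdsWithin_prod_eq, nhdsWithin_univ]
  exact prod_mem_prod ((chartAt (Coord d) u).open_source.mem_nhds hu) self_mem_nhdsWithin

theorem continuous_comp_Icc_of_continuousOn {E : Type*} [TopologicalSpace E]
    {g : USphere d × ℝ → E} (hg : ContinuousOn g (Set.univ ×ˢ Set.Ico 0 T)) {t₁ : ℝ}
    (ht₁ : t₁ < T) : Continuous fun q : Set.Icc 0 t₁ × USphere d => g (q.2, q.1) :=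
  hg.comp_continuous (by fun_prop)
    fun q => ⟨Set.mem_univ _, q.1.2.1, q.1.2.2.trans_lt ht₁⟩

theorem tendsto_of_continuousOn_prod_Ico {E : Type*} [TopologicalSpace E]
    {g : USphere d × ℝ → E} (hg : ContinuousOn g (Set.univ ×ˢ Set.Ico 0 T)) {t : ℝ}
    (ht : t ∈ Set.Ico 0 T) {u : USphere d} {τ : ℕ → ℝ} {w : ℕ → USphere d}
    (hτ : ∀ k, τ k ∈ Set.Ico 0 T) (hτt : Tendsto τ atTop (𝓝 t)) (hw : Tendsto w atTop (𝓝 u)) :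
    Tendsto (fun k => g (w k, τ k)) atTop (𝓝 (g (u, t))) :=
  (hg (u, t) ⟨Set.mem_univ _, ht⟩).tendsto.comp
    (tendsto_nhdsWithin_iff.mpr ⟨hw.prodMk_nhds hτt,
      Eventually.of_forall fun k => ⟨Set.mem_univ _, hτ k⟩⟩)

/-- Along a flow, a power of the centro-affine curvature stays bounded on compact time intervals. -/
theorem IsFlowSolution.exists_rpow_curvature_le (hd : 1 ≤ d) (hp0 : p ≠ 0)
    (hpn : p ≠ -((d : ℝ) + 1)) (h : IsFlowSolution p T K₀ K X ν) {t₁ : ℝ} (ht₁ : t₁ < T) :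
    ∃ M, 0 ≤ M ∧ ∀ t ∈ Set.Icc 0 t₁, ∀ u,
      centroAffineCurvature (X t) (ν t) u ^ (p / ((d : ℝ) + 1 + p)) ≤ M := by
  have hmemI : ∀ t ∈ Set.Icc 0 t₁, t ∈ Set.Ico 0 T := fun t ht => ⟨ht.1, ht.2.trans_lt ht₁⟩
  have hX := continuous_comp_Icc_of_continuousOn h.smooth.continuousOn ht₁
  have hV := continuous_comp_Icc_of_continuousOn h.continuousOn_velocity ht₁
  -- Triples of time, point and supporting direction. Treating the normal as a free variable under a
  -- closed condition gives compactness without continuity of `ν` in time. On `Q` the support value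
  -- is positive, and speed over support value bounds `κ₀ ^ a`.
  let Q : Set (Set.Icc 0 t₁ × USphere d × USphere d) :=
    {q | ∀ w, inner ℝ (X q.1 w) (q.2.2 : Space d) ≤ inner ℝ (X q.1 q.2.1) (q.2.2 : Space d)}
  have hX1 : Continuous fun q : Set.Icc 0 t₁ × USphere d × USphere d => X q.1 q.2.1 :=
    hX.comp (continuous_fst.prodMk (continuous_fst.comp continuous_snd))
  have hv : Continuous fun q : Set.Icc 0 t₁ × USphere d × USphere d => (q.2.2 : Space d) := by
    fun_prop
  have hQ : IsCompact Q := by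
    refine IsClosed.isCompact ?_
    simp only [Q, Set.ofPred_forall]
    refine isClosed_iInter fun w => isClosed_le (Continuous.inner ?_ hv) (hX1.inner hv)
    exact hX.comp (continuous_fst.prodMk continuous_const)
  have hQpos : ∀ q ∈ Q, 0 < inner ℝ (X q.1 q.2.1) (q.2.2 : Space d) := fun q hq =>
    (h.param _ (hmemI _ q.1.2)).inner_pos (h.body _ (hmemI _ q.1.2)) (by simp) hq
  have hcont : ContinuousOn (fun q : Set.Icc 0 t₁ × USphere d × USphere d =>
      ‖flowVelocity p (X q.1) (ν q.1) q.2.1‖ / inner ℝ (X q.1 q.2.1) (q.2.2 : Space d)) Q := by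
    refine ContinuousOn.div ?_ (hX1.inner hv).continuousOn fun q hq => (hQpos q hq).ne'
    exact (hV.comp (continuous_fst.prodMk
      (continuous_fst.comp continuous_snd))).norm.continuousOn
  obtain ⟨M, hM⟩ := (hQ.image_of_continuousOn hcont).bddAbove
  refine ⟨max M 0, le_max_right _ _, fun t ht u => le_max_of_le_left ?_⟩
  have hB := h.body t (hmemI t ht)
  have hP := h.param t (hmemI t ht)
  have hpos := hP.inner_normal_pos hB u
  refine le_trans ?_ (hM ⟨(⟨t, ht⟩, u, ⟨ν t u, by simp [hP.norm_normal]⟩),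
    fun w => hP.inner_le_normal hB u w, rfl⟩)
  simp only
  rw [le_div_iff₀ hpos]
  have hnp : (d : ℝ) + 1 + p ≠ 0 := fun h0 => hpn (by linarith)
  have hκ := Real.rpow_pos_of_pos (hP.centroAffineCurvature_pos hB u) (p / ((d : ℝ) + 1 + p))
  have h1 := abs_real_inner_le_norm (flowVelocity p (X t) (ν t) u) (ν t u)
  rw [hP.norm_normal, mul_one, hP.inner_flowVelocity hd hpn hB u, abs_mul, abs_neg, abs_mul,
    abs_of_pos hpos, abs_of_pos hκ] at h1
  have h2 : |Real.sign (p / ((d : ℝ) + 1 + p))| = 1 := by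
    rcases Real.sign_apply_eq_of_ne_zero _ (div_ne_zero hp0 hnp) with h3 | h3 <;> simp [h3]
  rwa [h2, one_mul] at h1

theorem IsFlowSolution.hasDerivAt (h : IsFlowSolution p T K₀ K X ν) {t : ℝ}
    (ht : t ∈ Set.Ioo 0 T) (u : USphere d) :
    HasDerivAt (fun s => X s u) (flowVelocity p (X t) (ν t) u) t :=
  (h.evolution t ⟨ht.1.le, ht.2⟩ u).hasDerivAt (Ico_mem_nhds ht.1 ht.2)

end Flow

/-! ### Normal speeds at a point of contact -/

section Comparison

variable {d : ℕ} {K K' : Set (Space d)} {X ν X' ν' : USphere d → Space d}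

/-- At a point of contact of `K` with the boundary of the dilate `exp s • K'` that contains it, the
normal speeds of the two bodies differ by at most a multiple of `s`. -/
theorem inner_flowVelocity_lt_of_touching (hd : 1 ≤ d) {p : ℝ} (hpn : p ≠ -((d : ℝ) + 1))
    (hB : IsCenteredBody K) (h : IsBoundaryParam K X ν) (hB' : IsCenteredBody K')
    (h' : IsBoundaryParam K' X' ν') {s M L : ℝ} (hs : 0 < s) (hs1 : s ≤ 1)
    (hcont : ∀ u (v : Space d), ‖v‖ = 1 → ∃ w, inner ℝ (X u) v ≤ Real.exp s * inner ℝ (X' w) v)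
    {u w : USphere d} {v : Space d} (hv : ‖v‖ = 1)
    (hbad : ∀ z, Real.exp s * inner ℝ (X' z) v ≤ inner ℝ (X u) v)
    (hw : inner ℝ (X u) v ≤ Real.exp s * inner ℝ (X' w) v)
    (hM : centroAffineCurvature X' ν' w ^ (p / ((d : ℝ) + 1 + p)) ≤ M)
    (hL : M * ((2 * ((d : ℝ) + 1)) * |p / ((d : ℝ) + 1 + p)| *
      Real.exp ((2 * ((d : ℝ) + 1)) * |p / ((d : ℝ) + 1 + p)|)) < L) :
    inner ℝ (flowVelocity p X ν u) v <
      L * s * Real.exp s * inner ℝ (X' w) v +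
        Real.exp s * inner ℝ (flowVelocity p X' ν' w) v := by
  set μ := Real.exp s with hμ
  have hμ0 : 0 < μ := Real.exp_pos s
  have hmax : ∀ z, inner ℝ (X z) v ≤ inner ℝ (X u) v := fun z => by
    obtain ⟨w', hw'⟩ := hcont z v hv
    exact hw'.trans (hbad w')
  have hmax' : ∀ z, inner ℝ (X' z) v ≤ inner ℝ (X' w) v := fun z =>
    le_of_mul_le_mul_left ((hbad z).trans hw) hμ0
  have heq : inner ℝ (X u) v = μ * inner ℝ (X' w) v := le_antisymm hw (hbad w)
  have hv0 : v ≠ 0 := by rintro rfl; simp at hv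
  have hmem : μ⁻¹ • X u ∈ K' := h'.mem_of_forall_inner_le hB' fun v₁ hv₁ => by
    obtain ⟨w', hw'⟩ := hcont u v₁ hv₁
    refine ⟨w', ?_⟩
    rw [inner_smul_left]
    simp only [conj_trivial]
    rwa [inv_mul_le_iff₀ hμ0]
  have hval : inner ℝ (μ⁻¹ • X u) v = inner ℝ (X' w) v := by
    rw [inner_smul_left, heq]
    simp only [conj_trivial]
    rw [inv_mul_cancel_left₀ hμ0.ne']
  have hfr : μ⁻¹ • X u ∈ frontier K' := mem_frontier_of_inner_le hv0 hmem fun z hz => by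
    rw [hval]
    exact h'.inner_le hB' hv hmax' hz
  rw [← h'.range_eq] at hfr
  obtain ⟨w', hw'⟩ := hfr
  -- Strict convexity of `K'`: the rescaled contact point and `X' w` both maximize `⟨·, v⟩`, so the
  -- maximizer `w` is the contact point itself.
  have hww : w' = w := h'.eq_of_inner_eq hB' hv hmax' (by rw [hw', hval])
  subst hww
  have hXX : X u = μ • X' w' := by rw [hw', smul_inv_smul₀ hμ0.ne']
  have hκ := h.centroAffineCurvature_le_of_touching hB hB' h' hμ0 (fun u₁ w₁ => by
    obtain ⟨w₂, hw₂⟩ := hcont u₁ (ν' w₁) (h'.norm_normal w₁)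
    exact hw₂.trans (by gcongr; exact h'.inner_le_normal hB' w₁ w₂)) hXX
  have hν := h.eq_normal hB hv hmax
  have hν' := h'.eq_normal hB' hv hmax'
  have hpos := h'.inner_pos hB' hv hmax'
  have hμN : μ ^ (2 * (d + 1)) = Real.exp (s * (2 * ((d : ℝ) + 1))) := by
    rw [hμ, ← Real.exp_nat_mul]
    congr 1
    push_cast
    ring
  rw [hμN] at hκ
  have hkey := sign_mul_rpow_sub_rpow_le (h'.centroAffineCurvature_pos hB' w') (by positivity) hs.le hs1 hκ hM
  have e1 := h.inner_flowVelocity hd hpn hB u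
  have e2 := h'.inner_flowVelocity hd hpn hB' w'
  rw [← hν, heq] at e1
  rw [← hν'] at e2
  rw [e1, e2]
  have hlt := hkey.trans_lt (mul_lt_mul_of_pos_right hL hs)
  have := mul_lt_mul_of_pos_right hlt (mul_pos hμ0 hpos)
  linarith

end Comparison

/-! ### First contact and the containment principle -/

section Containment

variable {d : ℕ} {p T T' : ℝ} {K₀ K₀' : Set (Space d)} {K K' : ℝ → Set (Space d)}
  {X ν X' ν' : ℝ → USphere d → Space d}

/-- If the first flow reaches the boundary of the dilates `μ t • K' t`, there is a first time at
which it does. -/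
theorem IsFlowSolution.exists_first_contact (h : IsFlowSolution p T K₀ K X ν)
    (h' : IsFlowSolution p T' K₀' K' X' ν') {μ : ℝ → ℝ} (hμ : Continuous μ) {t₁ : ℝ}
    (ht₁ : t₁ < T) (ht₁' : t₁ < T') {t : ℝ} (ht : t ∈ Set.Icc 0 t₁) {u : USphere d}
    {v : Space d} (hv : ‖v‖ = 1)
    (hbad : ∀ w, μ t * inner ℝ (X' t w) v ≤ inner ℝ (X t u) v) :
    ∃ t₀ ∈ Set.Icc 0 t₁, (∃ u₀ v₀, ‖v₀‖ = 1 ∧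
        ∀ w, μ t₀ * inner ℝ (X' t₀ w) v₀ ≤ inner ℝ (X t₀ u₀) v₀) ∧
      ∀ s, 0 ≤ s → s < t₀ → ∀ u₀ v₀, ‖v₀‖ = 1 →
        ∃ w, inner ℝ (X s u₀) v₀ < μ s * inner ℝ (X' s w) v₀ := by
  let Q : Set (Set.Icc 0 t₁ × USphere d × USphere d) :=
    {q | ∀ w, μ q.1 * inner ℝ (X' q.1 w) (q.2.2 : Space d) ≤
      inner ℝ (X q.1 q.2.1) (q.2.2 : Space d)}
  have hX := continuous_comp_Icc_of_continuousOn h.smooth.continuousOn ht₁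
  have hX' := continuous_comp_Icc_of_continuousOn h'.smooth.continuousOn ht₁'
  have hv' : Continuous fun q : Set.Icc 0 t₁ × USphere d × USphere d => (q.2.2 : Space d) := by
    fun_prop
  have hQ : IsCompact Q := by
    refine IsClosed.isCompact ?_
    simp only [Q, Set.ofPred_forall]
    refine isClosed_iInter fun w => isClosed_le (Continuous.mul (by fun_prop)
      (Continuous.inner ?_ hv')) (Continuous.inner ?_ hv')
    · exact hX'.comp (continuous_fst.prodMk continuous_const)
    · exact hX.comp (continuous_fst.prodMk (continuous_fst.comp continuous_snd))
  obtain ⟨q, hqQ, hqmin⟩ := hQ.exists_isMinOn ⟨(⟨t, ht⟩, u, ⟨v, by simpa using hv⟩), hbad⟩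
    (f := fun q => q.1) continuous_fst.continuousOn
  refine ⟨q.1, q.1.2, ⟨q.2.1, q.2.2, by simp, hqQ⟩, fun s hs hst u₀ v₀ hv₀ => ?_⟩
  by_contra! hcon
  have hmem : ((⟨s, hs, hst.le.trans q.1.2.2⟩ : Set.Icc 0 t₁), u₀,
    (⟨v₀, by simpa using hv₀⟩ : USphere d)) ∈ Q := hcon
  exact absurd (hqmin hmem) (not_le.mpr hst)

/-- The witness `w` may change with `s`; compactness of the sphere supplies a limit witness as `s`
increases to `t₀`. -/
theorem exists_seq_of_lt {t₀ : ℝ} (ht₀ : 0 < t₀) {φ : USphere d → ℝ → ℝ}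
    (h : ∀ s, 0 ≤ s → s < t₀ → ∃ w, φ w s < 0) :
    ∃ (τ : ℕ → ℝ) (x : ℕ → USphere d) (w : USphere d), (∀ k, τ k ∈ Set.Ioo 0 t₀) ∧
      Tendsto τ atTop (𝓝 t₀) ∧ Tendsto x atTop (𝓝 w) ∧ ∀ k, φ (x k) (τ k) < 0 := by
  obtain ⟨σ, -, hσ, hlim⟩ := exists_seq_strictMono_tendsto' ht₀
  choose y hy using fun k => h (σ k) (hσ k).1.le (hσ k).2
  obtain ⟨w, ψ, hψ, hw⟩ := CompactSpace.tendsto_subseq y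
  exact ⟨σ ∘ ψ, y ∘ ψ, w, fun k => hσ _, hlim.comp hψ.tendsto_atTop, hw, fun k => hy _⟩

/-- Separation of the inner body from the boundary of the slightly expanded outer body. -/
theorem IsFlowSolution.exists_inner_lt_exp (hd : 1 ≤ d) (hpn : p ≠ -((d : ℝ) + 1))
    (h : IsFlowSolution p T K₀ K X ν) (h' : IsFlowSolution p T' K₀' K' X' ν')
    (hsub : K₀ ⊆ K₀') {t₁ M L ε : ℝ} (ht₁ : t₁ < T) (ht₁' : t₁ < T')
    (hM : ∀ t ∈ Set.Icc 0 t₁, ∀ u,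
      centroAffineCurvature (X' t) (ν' t) u ^ (p / ((d : ℝ) + 1 + p)) ≤ M)
    (hL : M * ((2 * ((d : ℝ) + 1)) * |p / ((d : ℝ) + 1 + p)| *
      Real.exp ((2 * ((d : ℝ) + 1)) * |p / ((d : ℝ) + 1 + p)|)) < L) (hL0 : 0 ≤ L)
    (hε : 0 < ε) (hε1 : ε * Real.exp (L * t₁) ≤ 1) {t : ℝ} (ht : t ∈ Set.Icc 0 t₁)
    (u : USphere d) {v : Space d} (hv : ‖v‖ = 1) :
    ∃ w, inner ℝ (X t u) v < Real.exp (ε * Real.exp (L * t)) * inner ℝ (X' t w) v := by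
  by_contra! hcon
  set μ : ℝ → ℝ := fun t => Real.exp (ε * Real.exp (L * t)) with hμ
  have hμd : ∀ s, HasDerivAt μ (L * (ε * Real.exp (L * s)) * μ s) s := fun s => by
    have h1 : HasDerivAt (fun s : ℝ => L * s) L s := by
      simpa using (hasDerivAt_id s).const_mul L
    exact ((h1.exp.const_mul ε).exp).congr_deriv (by simp only [hμ]; ring)
  have hμc : Continuous μ := by fun_prop
  obtain ⟨t₀, ht₀, ⟨u₀, v₀, hv₀, hbad⟩, hfirst⟩ :=
    h.exists_first_contact h' hμc ht₁ ht₁' ht hv hcon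
  have hv0 : v₀ ≠ 0 := by rintro rfl; simp at hv₀
  have hI : t₀ ∈ Set.Ico 0 T := ⟨ht₀.1, ht₀.2.trans_lt ht₁⟩
  have hI' : t₀ ∈ Set.Ico 0 T' := ⟨ht₀.1, ht₀.2.trans_lt ht₁'⟩
  -- No contact at time `0`: there `K₀ ⊆ K₀'`, the support values of `K₀'` are positive, and `μ 0 =
  -- exp ε > 1`.
  have hpos : 0 < t₀ := by
    refine lt_of_le_of_ne ht₀.1 fun h0 => ?_
    subst h0
    obtain ⟨w, hw⟩ := (h'.param 0 hI').exists_inner_le (h'.body 0 hI') hv0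
    have h1 := hw (X 0 u₀) (by
      rw [h'.initial_body]
      apply hsub
      rw [← h.initial_body]
      exact (h.param 0 hI).mem (h.body 0 hI) u₀)
    have h2 := (h'.param 0 hI').inner_pos (h'.body 0 hI') hv₀ (u := w)
      fun z => hw _ ((h'.param 0 hI').mem (h'.body 0 hI') z)
    have h3 : 1 < μ 0 := by
      simp only [hμ]
      rw [Real.one_lt_exp_iff]
      positivity
    have h4 := hbad w
    nlinarith
  have hτI : ∀ {s}, s ∈ Set.Ioo 0 t₀ → s ∈ Set.Ico 0 T := fun hs =>
    ⟨hs.1.le, hs.2.trans hI.2⟩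
  have hτI' : ∀ {s}, s ∈ Set.Ioo 0 t₀ → s ∈ Set.Ico 0 T' := fun hs =>
    ⟨hs.1.le, hs.2.trans hI'.2⟩
  have hseq : ∀ u₁ (v₁ : Space d), ‖v₁‖ = 1 → ∃ (τ : ℕ → ℝ) (x : ℕ → USphere d) (w : USphere d),
      (∀ k, τ k ∈ Set.Ioo 0 t₀) ∧ Tendsto τ atTop (𝓝 t₀) ∧ Tendsto x atTop (𝓝 w) ∧
      (∀ k, inner ℝ (X (τ k) u₁) v₁ < μ (τ k) * inner ℝ (X' (τ k) (x k)) v₁) ∧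
      inner ℝ (X t₀ u₁) v₁ ≤ μ t₀ * inner ℝ (X' t₀ w) v₁ := by
    intro u₁ v₁ hv₁
    obtain ⟨τ, x, w, hτ, hτlim, hx, hneg⟩ := exists_seq_of_lt hpos
      (φ := fun w s => inner ℝ (X s u₁) v₁ - μ s * inner ℝ (X' s w) v₁)
      (fun s hs hst => by simpa using hfirst s hs hst u₁ v₁ hv₁)
    refine ⟨τ, x, w, hτ, hτlim, hx, fun k => sub_neg.mp (hneg k), ?_⟩
    have h1 := tendsto_of_continuousOn_prod_Ico h.smooth.continuousOn hI
      (fun k => hτI (hτ k)) hτlim (tendsto_const_nhds (x := u₁))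
    have h2 := tendsto_of_continuousOn_prod_Ico h'.smooth.continuousOn hI'
      (fun k => hτI' (hτ k)) hτlim hx
    exact le_of_tendsto_of_tendsto (h1.inner tendsto_const_nhds)
      (((hμc.tendsto t₀).comp hτlim).mul (h2.inner tendsto_const_nhds))
      (Eventually.of_forall fun k => (sub_neg.mp (hneg k)).le)
  obtain ⟨τ, x, w, hτ, hτlim, hx, hneg, hw⟩ := hseq u₀ v₀ hv₀
  set g : ℝ → USphere d → ℝ := fun s z => inner ℝ (flowVelocity p (X s) (ν s) u₀) v₀ -
    (L * (ε * Real.exp (L * s)) * μ s * inner ℝ (X' s z) v₀ +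
      μ s * inner ℝ (flowVelocity p (X' s) (ν' s) z) v₀) with hg
  have hderiv : ∀ s ∈ Set.Ioc 0 t₀, ∀ z,
      HasDerivAt (fun s => inner ℝ (X s u₀) v₀ - μ s * inner ℝ (X' s z) v₀) (g s z) s := by
    intro s hs z
    have h1 := (h.hasDerivAt ⟨hs.1, hs.2.trans_lt hI.2⟩ u₀).inner ℝ (hasDerivAt_const s v₀)
    have h2 := (h'.hasDerivAt ⟨hs.1, hs.2.trans_lt hI'.2⟩ z).inner ℝ (hasDerivAt_const s v₀)
    exact (h1.sub ((hμd s).mul h2)).congr_deriv (by simp [hg])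
  -- For the fixed witness `x k` the gap is negative at `τ k` but nonnegative at `t₀`, as `hbad`
  -- holds for every point. The limit yields `0 ≤ g t₀ w` at the contact point without
  -- differentiating a support function.
  have hmvt : ∀ k, ∃ s ∈ Set.Ioo (τ k) t₀, 0 ≤ g s (x k) := by
    intro k
    obtain ⟨s, hs, hslope⟩ := exists_hasDerivAt_eq_slope
      (fun s => inner ℝ (X s u₀) v₀ - μ s * inner ℝ (X' s (x k)) v₀) (fun s => g s (x k))
      (hτ k).2
      (fun s hs => (hderiv s ⟨(hτ k).1.trans_le hs.1, hs.2⟩ _).continuousAt.continuousWithinAt)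
      (fun s hs => hderiv s ⟨(hτ k).1.trans hs.1, hs.2.le⟩ _)
    refine ⟨s, hs, ?_⟩
    rw [hslope]
    have h1 := hbad (x k)
    have h2 := hneg k
    exact div_nonneg (by linarith) (by linarith [(hτ k).2])
  choose σ hσ hσg using hmvt
  have hσ0 : ∀ k, σ k ∈ Set.Ioo 0 t₀ := fun k => ⟨(hτ k).1.trans (hσ k).1, (hσ k).2⟩
  have hσlim : Tendsto σ atTop (𝓝 t₀) :=
    tendsto_of_tendsto_of_tendsto_of_le_of_le hτlim tendsto_const_nhds
      (fun k => (hσ k).1.le) (fun k => (hσ k).2.le)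
  have hglim : Tendsto (fun k => g (σ k) (x k)) atTop (𝓝 (g t₀ w)) := by
    have h1 := tendsto_of_continuousOn_prod_Ico h.continuousOn_velocity hI
      (fun k => hτI (hσ0 k)) hσlim (tendsto_const_nhds (x := u₀))
    have h2 := tendsto_of_continuousOn_prod_Ico h'.smooth.continuousOn hI'
      (fun k => hτI' (hσ0 k)) hσlim hx
    have h3 := tendsto_of_continuousOn_prod_Ico h'.continuousOn_velocity hI'
      (fun k => hτI' (hσ0 k)) hσlim hx
    have h4 := (hμc.tendsto t₀).comp hσlim
    have h5 : Tendsto (fun k => L * (ε * Real.exp (L * σ k))) atTop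
        (𝓝 (L * (ε * Real.exp (L * t₀)))) := by
      have : Continuous fun s : ℝ => L * (ε * Real.exp (L * s)) := by fun_prop
      exact (this.tendsto t₀).comp hσlim
    exact (h1.inner tendsto_const_nhds).sub
      (((h5.mul h4).mul (h2.inner tendsto_const_nhds)).add (h4.mul (h3.inner tendsto_const_nhds)))
  have hge : 0 ≤ g t₀ w := ge_of_tendsto' hglim hσg
  have hs1 : ε * Real.exp (L * t₀) ≤ 1 := by
    refine le_trans ?_ hε1
    have := ht₀.2
    gcongr
  have hlt := inner_flowVelocity_lt_of_touching hd hpn (h.body t₀ hI) (h.param t₀ hI)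
    (h'.body t₀ hI') (h'.param t₀ hI') (by positivity) hs1
    (fun u₁ v₁ hv₁ => by
      obtain ⟨-, -, w₁, -, -, -, -, hw₁⟩ := hseq u₁ v₁ hv₁
      exact ⟨w₁, hw₁⟩) hv₀ hbad hw (hM t₀ ht₀ w) hL
  simp only [hg, hμ] at hge
  linarith

theorem IsFlowSolution.subset_of_initial_subset (hd : 1 ≤ d) (hp0 : p ≠ 0)
    (hpn : p ≠ -((d : ℝ) + 1)) (h : IsFlowSolution p T K₀ K X ν)
    (h' : IsFlowSolution p T' K₀' K' X' ν') (hsub : K₀ ⊆ K₀') {t : ℝ} (ht0 : 0 ≤ t)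
    (ht : t < T) (ht' : t < T') : K t ⊆ K' t := by
  have hB := h.body t ⟨ht0, ht⟩
  have hP := h.param t ⟨ht0, ht⟩
  have hB' := h'.body t ⟨ht0, ht'⟩
  have hP' := h'.param t ⟨ht0, ht'⟩
  obtain ⟨M, hM0, hM⟩ := h'.exists_rpow_curvature_le hd hp0 hpn ht'
  set C := (2 * ((d : ℝ) + 1)) * |p / ((d : ℝ) + 1 + p)| *
    Real.exp ((2 * ((d : ℝ) + 1)) * |p / ((d : ℝ) + 1 + p)|) with hC
  have hC0 : 0 ≤ C := by positivity
  -- The summand `1` gives the strict inequality `M * C < L` that contradicts contact.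
  set L := M * C + 1 with hLdef
  intro x hx
  refine hP'.mem_of_forall_inner_le hB' fun v hv => ?_
  have hv0 : v ≠ 0 := by rintro rfl; simp at hv
  obtain ⟨u, hu⟩ := hP.exists_inner_le hB hv0
  obtain ⟨w, hw⟩ := hP'.exists_inner_le hB' hv0
  refine ⟨w, (hu x hx).trans ?_⟩
  have hlim : Tendsto (fun ε : ℝ => Real.exp (ε * Real.exp (L * t)) * inner ℝ (X' t w) v)
      (𝓝[>] 0) (𝓝 (inner ℝ (X' t w) v)) := by
    have : Continuous fun ε : ℝ => Real.exp (ε * Real.exp (L * t)) * inner ℝ (X' t w) v := by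
      fun_prop
    simpa using (this.tendsto 0).mono_left nhdsWithin_le_nhds
  refine ge_of_tendsto hlim ?_
  -- For these `ε` the exponent `log μ` stays at most `1` on `[0, t]`, the range where the linear
  -- estimate of the powers holds.
  filter_upwards [Ioc_mem_nhdsGT (Real.exp_pos (-(L * t)))] with ε hε
  have hε1 : ε * Real.exp (L * t) ≤ 1 := by
    have h1 := mul_le_mul_of_nonneg_right hε.2 (Real.exp_pos (L * t)).le
    rwa [← Real.exp_add, neg_add_cancel, Real.exp_zero] at h1
  obtain ⟨z, hz⟩ := h.exists_inner_lt_exp hd hpn h' hsub ht ht' hM (L := L)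
    (by rw [← hC, hLdef]; linarith) (by positivity) hε.1 hε1 ⟨ht0, le_rfl⟩ u hv
  refine hz.le.trans ?_
  gcongr
  exact hw _ (hP'.mem hB' z)

end Containment

end CentroAffine

/-- Containment principle for the `p`-flow in `ℝ^n`, `n = d + 1 ≥ 2`. -/
theorem proposition2p1 (d : ℕ) (hd : 1 ≤ d) (p : ℝ) (hp0 : p ≠ 0) (hpn : p ≠ -((d : ℝ) + 1))
    (K_in K_out : Set (CentroAffine.Space d))
    (h_in : K_in ∈ CentroAffine.SmoothBodies d) (h_out : K_out ∈ CentroAffine.SmoothBodies d)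
    (hsub : K_in ⊆ K_out)
    (T_in T_out : ℝ) (Kt_in Kt_out : ℝ → Set (CentroAffine.Space d))
    (hflow_in : CentroAffine.FlowsTo p T_in K_in Kt_in)
    (hflow_out : CentroAffine.FlowsTo p T_out K_out Kt_out)
    (t : ℝ) (ht0 : 0 ≤ t) (ht_in : t < T_in) (ht_out : t < T_out) :
    Kt_in t ⊆ Kt_out t := by
  obtain ⟨X, ν, h⟩ := hflow_in
  obtain ⟨X', ν', h'⟩ := hflow_out
  exact h.subset_of_initial_subset hd hp0 hpn h' hsub ht0 ht_in ht_out
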